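/- Setting. Let $m\ge 1$, $\lambda>0$, and $f_1,\dots,f_m:\mathbb{R}^d\to\mathbb{R}$; write $y=(y_1,\dots,y_m)\in\mathbb{R}^{md}$ with $y_i\in\mathbb{R}^d$; all norms are Euclidean. Put $F(x)=\sum_{i=1}^m f_i(x_i)$, $F^\star(u)=\sup_x\{u^\top x-F(x)\}$, $h_1(y)=F^\star(-y)$, $h_2(y)=\frac{1}{2\lambda}\bigl\|\sum_{i=1}^m y_i\bigr\|^2$, and for $h:\mathbb{R}^{md}\to\mathbb{R}$ let $h^\gamma(y)=\inf_z\{h(z)+\frac{1}{2\gamma}\|y-z\|^2\}$. The Douglas–Rachford envelope is $$H(y)=H_\gamma^{\mathrm{DR}}(y)=h_2^\gamma(y)-\gamma\|\nabla h_2^\gamma(y)\|^2+h_1^\gamma\bigl(y-2\gamma\nabla h_2^\gamma(y)\bigr).$$ Assumption 1: each $f_i$ is twice differentiable and there are constants $0<L_1\le L_2$ with $L_1I\preceq\nabla^2 f_i(x)\preceq L_2I$ for all $i$ and $x$. Assumption 2: there is a constant $L_3$ with $\|\nabla^2f_i(x)-\nabla^2f_i(x')\|\le L_3\|x-x'\|$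 for all $i$, $x$, $x'$. Algorithm QND2R. Given parameters $\sigma,\delta$, a matrix $B_0$ and two different points $y^0,y^1\in\mathbb{R}^{md}$, put $s_k=y^{k+1}-y^k$ and $z_k=\nabla H(y^{k+1})-\nabla H(y^k)$. In round $k=1,2,\dots$ compute $$B_k^{-1}=B_{k-1}^{-1}+\frac{(s^\top z+z^\top B_{k-1}^{-1}z)\,ss^\top}{(s^\top z)^2}-\frac{B_{k-1}^{-1}zs^\top+sz^\top B_{k-1}^{-1}}{s^\top z},\qquad s=s_{k-1},\ z=z_{k-1},$$ $$p^k=B_k^{-1}\nabla H(y^k),\qquad q_{k-1}=\frac{\|s_{k-1}-B_{k-1}^{-1}z_{k-1}\|}{\|B_{k-1}^{-1}s_{k-1}\|}+\frac1\gamma\|s_{k-1}\|+\|\nabla H(y^{k-1})\|,$$ and consider the conditions $$(\mathcal A_k)\quad q_{k-1}\ge\frac{(1-2\sigma)(p^k)^\top\nabla H(y^k)}{4\|p^k\|^2},\qquad(\mathcal B_k)\quad H(y^k-p^k)\le H(y^k)-\sigma(p^k)^\top\nabla H(y^k).$$ If $(\mathcal A_k)$ fails and $(\mathcal B_k)$ holds,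 set $\eta^k=1$ (the unit stepsize is accepted); otherwise set $\eta^k=\delta(p^k)^\top\nabla H(y^k)/\|p^k\|^2$. Then $y^{k+1}=y^k-\eta^kp^k$. If $\nabla H(y^k)=0$ for some $k\ge 1$, the run stays at $y^k$ from then on. Theorem 1. Let Assumptions 1 and 2 hold, let $\gamma=\frac{\lambda}{3m}$, $\sigma\in(0,\frac12)$, $\delta\in(0,\frac{\lambda}{3m})$, and let $B_0$ be symmetric positive definite. Then $H_\gamma^{\mathrm{DR}}$ has a unique minimizer $y^\star$, and the iterates of QND2R, from any two different starting points $y^0\ne y^1$, converge superlinearly to it: $y^k\to y^\star$ and $\|y^{k+1}-y^\star\|=o(\|y^k-y^\star\|)$ as $k\to\infty$. Moreover, for all sufficiently large $k$ with $y^k\ne y^\star$, the unit stepsize is accepted: $(\mathcal A_k)$ fails, $(\mathcal B_k)$ holds, and $\eta^k=1$. -/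

import Mathlib

noncomputable section

namespace QND2R

/-- The space `ℝ^d` of a single client, with the Euclidean norm. -/
abbrev Vec (d : ℕ) : Type := EuclideanSpace ℝ (Fin d)

/-- The space `ℝ^{md}` of stacked vectors `y = (y_1, …, y_m)`, with the Euclidean norm.
The coordinate `(i, j)` is the `j`-th coordinate of the block `y_i`. -/
abbrev Stack (m d : ℕ) : Type := EuclideanSpace ℝ (Fin m × Fin d)

/-- Real `md × md` matrices. -/
abbrev Mat (m d : ℕ) : Type := Matrix (Fin m × Fin d) (Fin m × Fin d) ℝ

/-- The block `y_i ∈ ℝ^d` of `y ∈ ℝ^{md}`. -/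
def block {m d : ℕ} (y : Stack m d) (i : Fin m) : Vec d :=
  WithLp.toLp 2 (fun j => y (i, j))

/-- The Hessian `∇²f(x)`, as the derivative of the gradient. -/
def hessian {d : ℕ} (f : Vec d → ℝ) (x : Vec d) : Vec d →L[ℝ] Vec d :=
  fderiv ℝ (gradient f) x

/-- Each `f_i` is twice differentiable and there are constants `0 < L₁ ≤ L₂` with
`L₁ I ⪯ ∇²f_i(x) ⪯ L₂ I` for all `i` and `x`. -/
def Assumption1 {m d : ℕ} (f : Fin m → Vec d → ℝ) : Prop :=
  (∀ i, Differentiable ℝ (f i) ∧ Differentiable ℝ (gradient (f i))) ∧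
  ∃ L₁ L₂ : ℝ, 0 < L₁ ∧ L₁ ≤ L₂ ∧ ∀ i x v,
    L₁ * ‖v‖ ^ 2 ≤ inner ℝ v (hessian (f i) x v) ∧
    inner ℝ v (hessian (f i) x v) ≤ L₂ * ‖v‖ ^ 2

/-- The Hessians of the `f_i` are Lipschitz continuous (in the operator norm). -/
def Assumption2 {m d : ℕ} (f : Fin m → Vec d → ℝ) : Prop :=
  ∃ L₃ : ℝ, ∀ i x y, ‖hessian (f i) x - hessian (f i) y‖ ≤ L₃ * ‖x - y‖

/-- `F(x) = ∑ f_i(x_i)`. -/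
def sumObjective {m d : ℕ} (f : Fin m → Vec d → ℝ) (x : Stack m d) : ℝ :=
  ∑ i, f i (block x i)

/-- The convex conjugate `F⋆(u) = sup_x {⟨u, x⟩ - F(x)}`. It is used only for strongly convex
`F` on a finite-dimensional space, for which the supremum is finite at every `u`. -/
def conjugate {m d : ℕ} (F : Stack m d → ℝ) (u : Stack m d) : ℝ :=
  ⨆ x : Stack m d, (inner ℝ u x - F x)

/-- `h₁(y) = F⋆(-y)`. -/
def h₁ {m d : ℕ} (f : Fin m → Vec d → ℝ) (y : Stack m d) : ℝ :=
  conjugate (sumObjective f) (-y)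

/-- `h₂(y) = (1 / 2λ) ‖∑ y_i‖²`. -/
def h₂ {m d : ℕ} (lam : ℝ) (y : Stack m d) : ℝ :=
  1 / (2 * lam) * ‖∑ i, block y i‖ ^ 2

/-- The Moreau envelope `h^γ(y) = inf_z {h(z) + (1 / 2γ) ‖y - z‖²}`. It is used only for
functions `h` that are bounded below. -/
def moreau {m d : ℕ} (γ : ℝ) (h : Stack m d → ℝ) (y : Stack m d) : ℝ :=
  ⨅ z : Stack m d, (h z + 1 / (2 * γ) * ‖y - z‖ ^ 2)

/-- The Douglas–Rachford envelope
`H(y) = h₂^γ(y) - γ ‖∇h₂^γ(y)‖² + h₁^γ(y - 2γ ∇h₂^γ(y))`. -/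
def envelope {m d : ℕ} (f : Fin m → Vec d → ℝ) (lam γ : ℝ) (y : Stack m d) : ℝ :=
  moreau γ (h₂ lam) y - γ * ‖gradient (moreau γ (h₂ lam)) y‖ ^ 2
    + moreau γ (h₁ f) (y - (2 * γ) • gradient (moreau γ (h₂ lam)) y)

/-- The product of a matrix and a stacked vector. -/
def act {m d : ℕ} (W : Mat m d) (v : Stack m d) : Stack m d :=
  WithLp.toLp 2 (W.mulVec v.ofLp)

/-- The rank-one matrix `u vᵀ`. -/
def outer {m d : ℕ} (u v : Stack m d) : Mat m d :=
  Matrix.vecMulVec u.ofLp v.ofLp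

/-- The BFGS update of the inverse Hessian approximation `W = B⁻¹` from `s` and `z`:
`W + (sᵀz + zᵀWz)(s sᵀ) / (sᵀz)² - (W z sᵀ + s zᵀ W) / (sᵀz)`. -/
def bfgsUpdate {m d : ℕ} (W : Mat m d) (s z : Stack m d) : Mat m d :=
  W + ((inner ℝ s z + inner ℝ z (act W z)) / (inner ℝ s z) ^ 2) • outer s s
    - (1 / inner ℝ s z) • (W * outer z s + outer s z * W)

/-- `s_k = y^{k+1} - y^k`. -/
def sVec {m d : ℕ} (y : ℕ → Stack m d) (k : ℕ) : Stack m d := y (k + 1) - y k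

/-- `z_k = ∇H(y^{k+1}) - ∇H(y^k)`. -/
def zVec {m d : ℕ} (H : Stack m d → ℝ) (y : ℕ → Stack m d) (k : ℕ) : Stack m d :=
  gradient H (y (k + 1)) - gradient H (y k)

/-- The search direction `p^k = B_k⁻¹ ∇H(y^k)`, where `W k = B_k⁻¹`. -/
def dir {m d : ℕ} (H : Stack m d → ℝ) (y : ℕ → Stack m d) (W : ℕ → Mat m d) (k : ℕ) :
    Stack m d :=
  act (W k) (gradient H (y k))

/-- `q_k = ‖s_k - B_k⁻¹ z_k‖ / ‖B_k⁻¹ s_k‖ + (1 / γ) ‖η^k p^k‖ + ‖∇H(y^k)‖`.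
Here `η^k p^k = y^k - y^{k+1} = -s_k`; written with `s_k` the formula also makes sense for `k = 0`,
where `y^0` and `y^1` are both initial data. -/
def qVal {m d : ℕ} (H : Stack m d → ℝ) (γ : ℝ) (y : ℕ → Stack m d) (W : ℕ → Mat m d)
    (k : ℕ) : ℝ :=
  ‖sVec y k - act (W k) (zVec H y k)‖ / ‖act (W k) (sVec y k)‖
    + 1 / γ * ‖sVec y k‖ + ‖gradient H (y k)‖

/-- Condition (A) of round `k ≥ 1`:
`q_{k-1} ≥ (1 - 2σ) (p^k)ᵀ ∇H(y^k) / (4 ‖p^k‖²)`. -/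
def CondA {m d : ℕ} (H : Stack m d → ℝ) (γ σ : ℝ) (y : ℕ → Stack m d) (W : ℕ → Mat m d)
    (k : ℕ) : Prop :=
  (1 - 2 * σ) * inner ℝ (dir H y W k) (gradient H (y k)) / (4 * ‖dir H y W k‖ ^ 2)
    ≤ qVal H γ y W (k - 1)

/-- Condition (B) of round `k`: `H(y^k - p^k) ≤ H(y^k) - σ (p^k)ᵀ ∇H(y^k)`. -/
def CondB {m d : ℕ} (H : Stack m d → ℝ) (σ : ℝ) (y : ℕ → Stack m d) (W : ℕ → Mat m d)
    (k : ℕ) : Prop :=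
  H (y k - dir H y W k) ≤ H (y k) - σ * inner ℝ (dir H y W k) (gradient H (y k))

/-- `y`, `W`, `η` are the iterates `y^k`, the matrices `B_k⁻¹` and the stepsizes `η^k` of the
algorithm QND2R for the function `H`, started from the matrix `B₀` and two different
points `y^0`, `y^1`. Rounds are numbered `k = 1, 2, …`. At a stationary point `p^k = 0`, so
`y^{k+1} = y^k`: a run that reaches a stationary point stays there. -/
structure IsRun {m d : ℕ} (H : Stack m d → ℝ) (γ σ δ : ℝ) (B₀ : Mat m d)
    (y : ℕ → Stack m d) (W : ℕ → Mat m d) (η : ℕ → ℝ) : Prop where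
  init_ne : y 0 ≠ y 1
  init_mat : W 0 = B₀⁻¹
  update_mat : ∀ k, 1 ≤ k →
    W k = bfgsUpdate (W (k - 1)) (sVec y (k - 1)) (zVec H y (k - 1))
  short_step : ∀ k, 1 ≤ k → (CondA H γ σ y W k ∨ ¬ CondB H σ y W k) →
    η k = δ * inner ℝ (dir H y W k) (gradient H (y k)) / ‖dir H y W k‖ ^ 2
  unit_step : ∀ k, 1 ≤ k → (¬ CondA H γ σ y W k ∧ CondB H σ y W k) → η k = 1
  update_point : ∀ k, 1 ≤ k → y (k + 1) = y k - η k • dir H y W k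

end QND2R

end

/-!
The matrices `B_k` of the algorithm are those of the BFGS method with an unusual choice of the
step length, and the proof is the Byrd–Nocedal analysis of that method, arranged around one
potential that serves for both global and local convergence.

*The envelope.* With `P` the projection onto consensus, `γ = λ / (3m)` gives
`h₂^γ(y) = ‖P y‖² / (8γ)` (`moreau_h₂`), and Fenchel duality gives
`h₁^γ(w) = -min_x {F x + γ/2 ‖x‖² + ⟨w, x⟩}` (`moreau_conjugate`). Hence
`H(y) = ‖P y‖² / (16γ) + h₁^γ(y - P y / 2)`, which is strongly convex, has a Lipschitz gradient `g`
with `⟨g u - g v, u - v⟩ ≤ ‖u - v‖² / γ`, and has a second-order model of `g` at each point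
(`envelope_regular`). In particular `H` has a unique minimizer `y⋆`; let `A` be its Hessian there
and `K = A⁻¹`.

*The potential.* Let `B = W⁻¹` and `ψ(B) = tr(K B) - log det B`. For a BFGS update along `s`, put
`r = ⟨Bs, KBs⟩ / ⟨s, Bs⟩`, `q = ⟨s, Bs⟩ / ⟨s, As⟩` and `τ = r - 1 - log q`. Then
`0 ≤ τ` and `ψ(B⁺) ≤ ψ(B) + ν - τ`, where `ν` is a multiple of the square of `‖z - As‖ / ‖s‖`
(`InversePair.potential_step`). A bound on `ψ` bounds `B` and `B⁻¹`
(`exists_bounds_of_potential_le`).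

*Global convergence.* Steps of either kind shrink the gap `H(y) - H(y⋆)` by a factor
`1 - c e^{-τ}` (`exists_gap_step`); short steps do so because `δ < γ`. A large `τ` spoils this
factor but lowers `ψ`, so `log gap` plus a multiple of `ψ` decreases linearly, and the gap decays
geometrically (`tendsto_of_potential`).

*Superlinear convergence.* Since the gap is now summable, so are `ν` and then `τ`. Thus `ψ` is
bounded and `r, q → 1`, which is the Dennis–Moré property `‖(B_k - A) s_k‖ = o(‖s_k‖)`
(`IsRun.dennis_more`). It makes the ratio in `q_{k-1}` tend to zero while
`⟨p, g⟩ / ‖p‖²` stays away from zero, so condition (A) fails; a Taylor expansion yields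
condition (B) because `σ < 1/2`; and unit steps are then superlinear
(`IsRun.superlinear_of_ne`). A run that meets a stationary point stops at `y⋆`.
-/

namespace QND2R

/-! ### Regular strongly convex functions -/

section Regular

variable {E : Type*} [NormedAddCommGroup E] [InnerProductSpace ℝ E]

/-- `Φ` is `μ`-strongly convex with `ℓ`-Lipschitz gradient `g`, and around each point `g` has an
affine model with symmetric linear part whose error is of second order. Differentiability is not a
field: the subgradient inequality and the continuity of `g` imply that `g` is the gradient of `Φ`
(`RegularConvex.hasGradientAt`). The last field holds when `Φ` has a Lipschitz Hessian; it is
required on the whole space, with a constant that may depend on `x`. -/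
structure RegularConvex (Φ : E → ℝ) (g : E → E) (μ ℓ : ℝ) : Prop where
  mu_pos : 0 < μ
  lip_pos : 0 < ℓ
  subgrad : ∀ u v, Φ v + inner ℝ (g v) (u - v) ≤ Φ u
  strong : ∀ u v, μ * ‖u - v‖ ^ 2 ≤ inner ℝ (g u - g v) (u - v)
  lip : ∀ u v, ‖g u - g v‖ ≤ ℓ * ‖u - v‖
  hess : ∀ x, ∃ A : E →L[ℝ] E, (∀ u v, inner ℝ (A u) v = inner ℝ u (A v)) ∧
    ∃ C, 0 ≤ C ∧ ∀ u v, ‖g u - g v - A (u - v)‖ ≤ C * (‖u - x‖ + ‖v - x‖) * ‖u - v‖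

/-- A continuous selection of subgradients is a gradient. -/
theorem hasGradientAt_of_subgradient [CompleteSpace E] {Φ : E → ℝ} {g : E → E}
    (hsub : ∀ u v, Φ v + inner ℝ (g v) (u - v) ≤ Φ u) (hg : Continuous g) (x : E) :
    HasGradientAt Φ (g x) x := by
  rw [hasGradientAt_iff_isLittleO, Asymptotics.isLittleO_iff]
  intro c hc
  have h1 : ∀ᶠ u in nhds x, ‖g u - g x‖ < c := by
    have := (hg.tendsto x).sub_const (g x)
    rw [sub_self] at this
    have := this.norm
    rw [norm_zero] at this
    exact this.eventually (gt_mem_nhds hc)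
  filter_upwards [h1] with u hu
  have h2 := hsub u x
  have h3 := hsub x u
  have h4 : inner ℝ (g u) (x - u) = - inner ℝ (g x) (u - x) - inner ℝ (g u - g x) (u - x) := by
    rw [inner_sub_left, ← neg_sub u x, inner_neg_right]; ring
  have h5 := real_inner_le_norm (g u - g x) (u - x)
  have h6 : ‖g u - g x‖ * ‖u - x‖ ≤ c * ‖u - x‖ := by gcongr
  rw [Real.norm_eq_abs, abs_le]
  constructor <;> nlinarith [norm_nonneg (u - x)]

/-- A coercive symmetric operator is invertible, with symmetric inverse. -/
theorem exists_symmetric_inverse [FiniteDimensional ℝ E] {A : E →L[ℝ] E} {μ : ℝ}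
    (hμ : 0 < μ) (hA : ∀ u v, inner ℝ (A u) v = inner ℝ u (A v))
    (hpos : ∀ v, μ * ‖v‖ ^ 2 ≤ inner ℝ (A v) v) :
    ∃ K : E →L[ℝ] E, (∀ v, A (K v) = v) ∧ (∀ v, K (A v) = v) ∧
      (∀ u v, inner ℝ (K u) v = inner ℝ u (K v)) ∧ ∀ v, ‖K v‖ ≤ 1 / μ * ‖v‖ := by
  have hlow : ∀ v, μ * ‖v‖ ≤ ‖A v‖ := fun v => by
    have h1 := hpos v
    have h2 := real_inner_le_norm (A v) v
    rcases (norm_nonneg v).eq_or_lt with h0 | h0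
    · rw [← h0]; simp
    · nlinarith
  have hinj : Function.Injective (A : E →ₗ[ℝ] E) := by
    rw [injective_iff_map_eq_zero]
    intro v hv
    have h1 := hlow v
    rw [show A v = 0 from hv, norm_zero] at h1
    exact norm_eq_zero.1 (le_antisymm (by nlinarith) (norm_nonneg v))
  let e := LinearEquiv.ofInjectiveEndo (A : E →ₗ[ℝ] E) hinj
  have h1 : ∀ v, A (e.symm v) = v := fun v => e.apply_symm_apply v
  refine ⟨LinearMap.toContinuousLinearMap (e.symm : E →ₗ[ℝ] E), h1,
    fun v => e.symm_apply_apply v, fun u v => ?_, fun v => ?_⟩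
  · have := hA (e.symm u) (e.symm v)
    rw [h1, h1] at this
    exact this.symm
  · have := hlow (e.symm v)
    rw [h1] at this
    rw [one_div, ← div_eq_inv_mul, le_div_iff₀ hμ]
    simpa [mul_comm] using this

namespace RegularConvex

variable {Φ : E → ℝ} {g : E → E} {μ ℓ : ℝ}

theorem continuous_grad (h : RegularConvex Φ g μ ℓ) : Continuous g :=
  (LipschitzWith.of_dist_le_mul (K := ⟨ℓ, h.lip_pos.le⟩)
    (fun u v => by rw [dist_eq_norm, dist_eq_norm]; exact h.lip u v)).continuous

theorem hasGradientAt [CompleteSpace E] (h : RegularConvex Φ g μ ℓ) (x : E) :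
    HasGradientAt Φ (g x) x :=
  hasGradientAt_of_subgradient h.subgrad h.continuous_grad x

theorem continuous [CompleteSpace E] (h : RegularConvex Φ g μ ℓ) : Continuous Φ :=
  continuous_iff_continuousAt.2 fun x => (h.hasGradientAt x).continuousAt

theorem mul_norm_le (h : RegularConvex Φ g μ ℓ) (u v : E) : μ * ‖u - v‖ ≤ ‖g u - g v‖ := by
  have h1 := h.strong u v
  have h2 := real_inner_le_norm (g u - g v) (u - v)
  rcases (norm_nonneg (u - v)).eq_or_lt with h0 | h0
  · rw [← h0]; simp
  · nlinarith

/-- Quadratic growth, by applying the subgradient inequality at the midpoint. The constant is not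
the sharp `μ / 2`. -/
theorem quadratic_growth (h : RegularConvex Φ g μ ℓ) (u v : E) :
    Φ v + inner ℝ (g v) (u - v) + μ / 4 * ‖u - v‖ ^ 2 ≤ Φ u := by
  set w : E := v + (1 / 2 : ℝ) • (u - v) with hw
  have e1 : u - w = (1 / 2 : ℝ) • (u - v) := by rw [hw]; module
  have e2 : w - v = (1 / 2 : ℝ) • (u - v) := by rw [hw]; module
  have h1 := h.subgrad u w
  have h2 := h.subgrad w v
  have h3 := h.strong w v
  rw [e1] at h1
  rw [e2] at h2 h3
  rw [norm_smul, inner_smul_right, inner_sub_left] at h3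
  rw [inner_smul_right] at h1 h2
  norm_num at h1 h2 h3
  nlinarith

theorem exists_grad_eq_zero [FiniteDimensional ℝ E] (h : RegularConvex Φ g μ ℓ) :
    ∃ x, g x = 0 ∧ ∀ u, Φ x ≤ Φ u := by
  have hlim : Filter.Tendsto Φ (Filter.cocompact E) Filter.atTop := by
    have h1 : Filter.Tendsto (fun t : ℝ => μ / 4 * t ^ 2 - ‖g 0‖ * t + Φ 0) Filter.atTop
        Filter.atTop := by
      apply Filter.tendsto_atTop_add_const_right
      have : (fun t : ℝ => μ / 4 * t ^ 2 - ‖g 0‖ * t) = fun t => t * (μ / 4 * t - ‖g 0‖) := by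
        funext t; ring
      rw [this]
      apply Filter.Tendsto.atTop_mul_atTop₀ Filter.tendsto_id
      exact Filter.tendsto_atTop_add_const_right _ _
        (Filter.tendsto_id.const_mul_atTop (by linarith [h.mu_pos]))
    refine Filter.tendsto_atTop_mono (fun u => ?_) (h1.comp (tendsto_norm_cocompact_atTop (E := E)))
    have h2 := h.quadratic_growth u 0
    have h3 := neg_le_of_abs_le (abs_real_inner_le_norm (g 0) u)
    simp only [sub_zero, Function.comp] at h2 ⊢
    linarith
  obtain ⟨x, hx⟩ := h.continuous.exists_forall_le hlim
  refine ⟨x, ?_, hx⟩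
  have h1 : IsLocalMin Φ x := Filter.Eventually.of_forall hx
  have h2 := h1.hasFDerivAt_eq_zero (h.hasGradientAt x).hasFDerivAt
  simpa using h2

/-- The Hessian inherits the strong convexity constant. -/
theorem model_coercive (h : RegularConvex Φ g μ ℓ) {x : E} {A : E →L[ℝ] E} {C : ℝ}
    (hA : ∀ u v, ‖g u - g v - A (u - v)‖ ≤ C * (‖u - x‖ + ‖v - x‖) * ‖u - v‖) (v : E) :
    μ * ‖v‖ ^ 2 ≤ inner ℝ (A v) v := by
  have key : ∀ t : ℝ, 0 < t → μ * ‖v‖ ^ 2 - C * ‖v‖ ^ 3 * t ≤ inner ℝ (A v) v := by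
    intro t ht
    have h1 := h.strong (x + t • v) x
    have h2 := hA (x + t • v) x
    simp only [add_sub_cancel_left, sub_self, norm_zero, add_zero, norm_smul, map_smul,
      inner_smul_right, Real.norm_eq_abs, abs_of_pos ht] at h1 h2
    have h3 := real_inner_le_norm (g (x + t • v) - g x - t • A v) v
    rw [inner_sub_left, inner_smul_left] at h3
    simp only [conj_trivial] at h3
    have h4 : ‖g (x + t • v) - g x - t • A v‖ * ‖v‖ ≤ C * (t * ‖v‖) * (t * ‖v‖) * ‖v‖ := by gcongr
    have h5 : t * t * (μ * ‖v‖ ^ 2 - C * ‖v‖ ^ 3 * t) ≤ t * t * inner ℝ (A v) v := by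
      nlinarith
    exact le_of_mul_le_mul_left h5 (by positivity)
  have hlim : Filter.Tendsto (fun t : ℝ => μ * ‖v‖ ^ 2 - C * ‖v‖ ^ 3 * t)
      (nhdsWithin 0 (Set.Ioi 0)) (nhds (μ * ‖v‖ ^ 2 - C * ‖v‖ ^ 3 * 0)) :=
    ((by fun_prop : Continuous fun t : ℝ => μ * ‖v‖ ^ 2 - C * ‖v‖ ^ 3 * t).tendsto 0).mono_left
      nhdsWithin_le_nhds
  rw [mul_zero, sub_zero] at hlim
  exact le_of_tendsto hlim (by filter_upwards [self_mem_nhdsWithin] with t ht using key t ht)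

/-- Second-order Taylor upper bound along the segment from `v` to `v + w`. -/
theorem taylor_upper [CompleteSpace E] (h : RegularConvex Φ g μ ℓ) {x : E} {A : E →L[ℝ] E} {C : ℝ}
    (hC : 0 ≤ C)
    (hA : ∀ u v, ‖g u - g v - A (u - v)‖ ≤ C * (‖u - x‖ + ‖v - x‖) * ‖u - v‖) (v w : E) :
    Φ (v + w) ≤ Φ v + inner ℝ (g v) w + inner ℝ (A w) w / 2
      + C * (2 * ‖v - x‖ + ‖w‖) * ‖w‖ ^ 2 := by
  set θ : ℝ → ℝ := fun t => Φ (v + t • w) - t * inner ℝ (g v) w - t ^ 2 / 2 * inner ℝ (A w) w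
    with hθ
  have hd : ∀ t, HasDerivAt θ (inner ℝ (g (v + t • w)) w - inner ℝ (g v) w
      - t * inner ℝ (A w) w) t := by
    intro t
    have h1 : HasDerivAt (fun t : ℝ => v + t • w) w t := by
      simpa using ((hasDerivAt_id t).smul_const w).const_add v
    have h2 := (h.hasGradientAt (v + t • w)).hasFDerivAt.comp_hasDerivAt t h1
    have h3 : HasDerivAt (fun t : ℝ => t * inner ℝ (g v) w) (inner ℝ (g v) w) t := by
      simpa using (hasDerivAt_id t).mul_const (inner ℝ (g v) w)
    have h4 : HasDerivAt (fun t : ℝ => t ^ 2 / 2 * inner ℝ (A w) w) (t * inner ℝ (A w) w) t := by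
      have := (((hasDerivAt_id' t).fun_pow 2).div_const 2).mul_const (inner ℝ (A w) w)
      refine this.congr_deriv ?_
      push_cast
      ring
    exact (h2.sub h3).sub h4
  obtain ⟨t, ht, he⟩ := exists_deriv_eq_slope θ (zero_lt_one)
    (fun t _ => (hd t).continuousAt.continuousWithinAt)
    (fun t _ => (hd t).differentiableAt.differentiableWithinAt)
  rw [(hd t).deriv] at he
  simp only [hθ, one_smul, one_mul, one_pow, zero_smul, add_zero, zero_mul, sub_zero, div_one,
    ne_eq, OfNat.ofNat_ne_zero, not_false_eq_true, zero_pow, zero_div] at he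
  have h1 := hA (v + t • w) v
  simp only [add_sub_cancel_left, map_smul, norm_smul, Real.norm_eq_abs, abs_of_pos ht.1] at h1
  have h2 := real_inner_le_norm (g (v + t • w) - g v - t • A w) w
  rw [inner_sub_left, inner_sub_left, inner_smul_left] at h2
  simp only [conj_trivial] at h2
  have h3 : ‖v + t • w - x‖ ≤ ‖v - x‖ + ‖w‖ := by
    calc ‖v + t • w - x‖ = ‖(v - x) + t • w‖ := by congr 1; module
      _ ≤ ‖v - x‖ + ‖t • w‖ := norm_add_le _ _
      _ ≤ ‖v - x‖ + ‖w‖ := by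
        rw [norm_smul, Real.norm_eq_abs, abs_of_pos ht.1]
        nlinarith [norm_nonneg w, ht.2]
  have h4 : ‖g (v + t • w) - g v - t • A w‖ ≤ C * (2 * ‖v - x‖ + ‖w‖) * ‖w‖ := by
    refine h1.trans ?_
    have h5 : t * ‖w‖ ≤ ‖w‖ := by nlinarith [norm_nonneg w, ht.2]
    have h6 : ‖v + t • w - x‖ + ‖v - x‖ ≤ 2 * ‖v - x‖ + ‖w‖ := by linarith
    gcongr
    exact mul_nonneg ht.1.le (norm_nonneg w)
  nlinarith [norm_nonneg w]

/-- Adding the quadratic `c / 2 * ⟨Q u, u⟩` for a positive semidefinite operator `Q`. -/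
theorem add_quadratic (h : RegularConvex Φ g μ ℓ) {c : ℝ} (hc : 0 ≤ c) {Q : E →L[ℝ] E}
    (hQ : ∀ u v, inner ℝ (Q u) v = inner ℝ u (Q v)) (hpos : ∀ u, 0 ≤ inner ℝ (Q u) u) :
    RegularConvex (fun u => Φ u + c / 2 * inner ℝ (Q u) u) (fun u => g u + c • Q u)
      μ (ℓ + c * ‖Q‖) where
  mu_pos := h.mu_pos
  lip_pos := by have := h.lip_pos; positivity
  subgrad u v := by
    have h1 := h.subgrad u v
    have h2 := hpos (u - v)
    have h3 : inner ℝ (Q u) v = inner ℝ (Q v) u := by rw [hQ, real_inner_comm]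
    simp only [map_sub, inner_sub_left, inner_sub_right, inner_add_left, inner_smul_left,
      conj_trivial] at h1 h2 ⊢
    nlinarith
  strong u v := by
    have h1 := h.strong u v
    have h2 := mul_nonneg hc (hpos (u - v))
    have : g u + c • Q u - (g v + c • Q v) = (g u - g v) + c • Q (u - v) := by
      rw [map_sub]; module
    rw [this, inner_add_left, inner_smul_left]
    simp only [conj_trivial]
    linarith
  lip u v := by
    have : g u + c • Q u - (g v + c • Q v) = (g u - g v) + c • Q (u - v) := by
      rw [map_sub]; module
    rw [this]
    calc _ ≤ ‖g u - g v‖ + ‖c • Q (u - v)‖ := norm_add_le _ _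
      _ ≤ ℓ * ‖u - v‖ + c * (‖Q‖ * ‖u - v‖) := by
        rw [norm_smul, Real.norm_eq_abs, abs_of_nonneg hc]
        gcongr
        · exact h.lip u v
        · exact Q.le_opNorm _
      _ = _ := by ring
  hess x := by
    obtain ⟨A, hA, C, hC, hAC⟩ := h.hess x
    refine ⟨A + c • Q, fun u v => ?_, C, hC, fun u v => ?_⟩
    · simp [inner_add_left, inner_add_right, inner_smul_left, inner_smul_right, hA, hQ]
    · convert hAC u v using 2
      simp only [add_apply, smul_apply, map_sub]
      module

/-- Composition with a symmetric operator bounded below. -/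
theorem comp_symmetric (h : RegularConvex Φ g μ ℓ) {R : E →L[ℝ] E} {ρ : ℝ} (hρ : 0 < ρ)
    (hR : ∀ u v, inner ℝ (R u) v = inner ℝ u (R v)) (hlow : ∀ u, ρ * ‖u‖ ≤ ‖R u‖) :
    RegularConvex (fun u => Φ (R u)) (fun u => R (g (R u))) (μ * ρ ^ 2) (ℓ * (‖R‖ + 1) ^ 2) where
  mu_pos := by have := h.mu_pos; positivity
  lip_pos := by have := h.lip_pos; positivity
  subgrad u v := by
    have := h.subgrad (R u) (R v)
    rwa [← map_sub, ← hR] at this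
  strong u v := by
    have h1 := h.strong (R u) (R v)
    have h2 : (ρ * ‖u - v‖) ^ 2 ≤ ‖R (u - v)‖ ^ 2 := by
      have := hlow (u - v); gcongr
    rw [← map_sub, hR, map_sub]
    have := h.mu_pos
    rw [map_sub] at h2
    nlinarith
  lip u v := by
    have hR1 : ∀ w, ‖R w‖ ≤ (‖R‖ + 1) * ‖w‖ := fun w =>
      (R.le_opNorm w).trans (by gcongr; linarith)
    have := h.lip_pos
    rw [← map_sub]
    calc _ ≤ (‖R‖ + 1) * ‖g (R u) - g (R v)‖ := hR1 _
      _ ≤ (‖R‖ + 1) * (ℓ * ‖R u - R v‖) := by gcongr; exact h.lip _ _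
      _ ≤ (‖R‖ + 1) * (ℓ * ((‖R‖ + 1) * ‖u - v‖)) := by
        rw [← map_sub]; gcongr; exact hR1 _
      _ = _ := by ring
  hess x := by
    obtain ⟨A, hA, C, hC, hAC⟩ := h.hess (R x)
    refine ⟨R.comp (A.comp R), fun u v => by simp [hR, hA], ‖R‖ * (C * ‖R‖ * ‖R‖), by positivity,
      fun u v => ?_⟩
    have := hAC (R u) (R v)
    have e : R (g (R u)) - R (g (R v)) - R.comp (A.comp R) (u - v)
        = R (g (R u) - g (R v) - A (R u - R v)) := by simp
    rw [e]
    calc _ ≤ ‖R‖ * (C * (‖R u - R x‖ + ‖R v - R x‖) * ‖R u - R v‖) :=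
          (R.le_opNorm _).trans (by gcongr)
      _ ≤ ‖R‖ * (C * (‖R‖ * ‖u - x‖ + ‖R‖ * ‖v - x‖) * (‖R‖ * ‖u - v‖)) := by
        simp only [← map_sub]
        gcongr <;> exact R.le_opNorm _
      _ = _ := by ring

theorem add_linear (h : RegularConvex Φ g μ ℓ) (w : E) :
    RegularConvex (fun x => Φ x + inner ℝ w x) (fun x => g x + w) μ ℓ where
  mu_pos := h.mu_pos
  lip_pos := h.lip_pos
  subgrad u v := by
    have := h.subgrad u v
    simp only [inner_add_left, inner_sub_right] at this ⊢
    linarith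
  strong u v := by simpa using h.strong u v
  lip u v := by simpa using h.lip u v
  hess x := by simpa using h.hess x

/-- Conjugation at `-w`: the function `w ↦ sup_x {-⟨w, x⟩ - Φ x}`, whose supremum is attained at
the solution `X w` of `g x = -w`, is again regular, with gradient `-X`. -/
theorem conjugate [FiniteDimensional ℝ E] (h : RegularConvex Φ g μ ℓ) :
    ∃ X : E → E, (∀ w, g (X w) = -w) ∧
      RegularConvex (fun w => -(Φ (X w) + inner ℝ w (X w))) (fun w => -X w) (μ / ℓ ^ 2) (1 / μ) ∧
      ∀ u v, inner ℝ (-X u - -X v) (u - v) ≤ 1 / μ * ‖u - v‖ ^ 2 := by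
  have hex : ∀ w, ∃ x, g x = -w := fun w => by
    obtain ⟨x, hx, -⟩ := (h.add_linear w).exists_grad_eq_zero
    exact ⟨x, eq_neg_of_add_eq_zero_left hx⟩
  choose X hX using hex
  have hμ := h.mu_pos
  have hlip : ∀ u v, ‖X u - X v‖ ≤ 1 / μ * ‖u - v‖ := fun u v => by
    have h1 := h.mul_norm_le (X u) (X v)
    rw [hX, hX, show -u - -v = -(u - v) by abel, norm_neg] at h1
    rw [one_div, ← div_eq_inv_mul, le_div_iff₀ hμ]
    linarith
  have hlip' : ∀ u v, ‖-X u - -X v‖ ≤ 1 / μ * ‖u - v‖ := fun u v => by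
    rw [show -X u - -X v = -(X u - X v) by abel, norm_neg]
    exact hlip u v
  have hinner : ∀ u v, inner ℝ (-X u - -X v) (u - v) =
      inner ℝ (g (X u) - g (X v)) (X u - X v) := fun u v => by
    rw [hX, hX, real_inner_comm, ← inner_neg_neg]
    congr 1 <;> abel
  refine ⟨X, hX, ⟨div_pos hμ (pow_pos h.lip_pos 2), by positivity, fun u v => ?_, fun u v => ?_,
    hlip', fun x => ?_⟩, fun u v => ?_⟩
  · have h1 := h.subgrad (X v) (X u)
    rw [hX] at h1
    simp only [inner_sub_right, inner_neg_left] at h1 ⊢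
    rw [real_inner_comm (X v) v, real_inner_comm (X v) u] at *
    linarith
  · have h1 := h.strong (X u) (X v)
    have h2 := h.lip (X u) (X v)
    rw [hX, hX, show -u - -v = -(u - v) by abel, norm_neg] at h2
    rw [hinner]
    refine le_trans ?_ h1
    have h3 : ‖u - v‖ ^ 2 ≤ (ℓ * ‖X u - X v‖) ^ 2 := by gcongr
    have := h.lip_pos
    rw [div_mul_eq_mul_div, div_le_iff₀ (by positivity)]
    nlinarith
  · obtain ⟨A, hA, C, hC, hAC⟩ := h.hess (X x)
    obtain ⟨K, -, hKA, hKs, hKn⟩ := exists_symmetric_inverse hμ hA (h.model_coercive hAC)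
    refine ⟨K, hKs, 1 / μ * (C * (1 / μ) * (1 / μ)), by positivity, fun u v => ?_⟩
    have e : -X u - -X v - K (u - v) = K (g (X u) - g (X v) - A (X u - X v)) := by
      rw [map_sub K _ (A _), hKA, hX, hX, show -u - -v = -(u - v) by abel, map_neg]
      abel
    rw [e]
    calc _ ≤ 1 / μ * (C * (‖X u - X x‖ + ‖X v - X x‖) * ‖X u - X v‖) :=
          (hKn _).trans (by gcongr; exact hAC _ _)
      _ ≤ 1 / μ * (C * (1 / μ * ‖u - x‖ + 1 / μ * ‖v - x‖) * (1 / μ * ‖u - v‖)) := by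
        gcongr <;> exact hlip _ _
      _ = _ := by ring
  · have h1 := real_inner_le_norm (-X u - -X v) (u - v)
    nlinarith [hlip' u v, norm_nonneg (u - v)]

end RegularConvex

end Regular

/-! ### Regularity from Hessian bounds -/

/-- The bounds and the Lipschitz condition on the Hessian give regularity; the symmetry of the
Hessian is that of second derivatives. -/
theorem RegularConvex.of_hessian {E : Type*} [NormedAddCommGroup E] [InnerProductSpace ℝ E]
    [CompleteSpace E] {f : E → ℝ} (hf : Differentiable ℝ f) (hg : Differentiable ℝ (gradient f))
    {L₁ L₂ L₃ : ℝ} (h1 : 0 < L₁) (h12 : L₁ ≤ L₂)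
    (hlow : ∀ x v, L₁ * ‖v‖ ^ 2 ≤ inner ℝ v (fderiv ℝ (gradient f) x v))
    (hupp : ∀ x v, inner ℝ v (fderiv ℝ (gradient f) x v) ≤ L₂ * ‖v‖ ^ 2)
    (hlip : ∀ x y, ‖fderiv ℝ (gradient f) x - fderiv ℝ (gradient f) y‖ ≤ L₃ * ‖x - y‖) :
    RegularConvex f (gradient f) L₁ L₂ := by
  have hL2 : 0 < L₂ := h1.trans_le h12
  have hsymm : ∀ x u v, inner ℝ (fderiv ℝ (gradient f) x u) v
      = inner ℝ u (fderiv ℝ (gradient f) x v) := fun x u v => by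
    have h2 : HasFDerivAt (fun y => InnerProductSpace.toDual ℝ E (gradient f y))
        ((InnerProductSpace.toDual ℝ E).toContinuousLinearEquiv.toContinuousLinearMap.comp
          (fderiv ℝ (gradient f) x)) x :=
      ((InnerProductSpace.toDual ℝ E).toContinuousLinearEquiv.hasFDerivAt).comp x
        (hg x).hasFDerivAt
    have h3 := second_derivative_symmetric
      (fun y => (hf y).hasGradientAt.hasFDerivAt) h2 u v
    have h4 : inner ℝ (fderiv ℝ (gradient f) x u) v = inner ℝ (fderiv ℝ (gradient f) x v) u := by
      simpa using h3
    rw [h4, real_inner_comm]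
  have hline : ∀ (v w : E) (t : ℝ), HasDerivAt (fun t : ℝ => v + t • w) w t := fun v w t => by
    simpa using ((hasDerivAt_id t).smul_const w).const_add v
  have hstrong : ∀ u v, L₁ * ‖u - v‖ ^ 2 ≤ inner ℝ (gradient f u - gradient f v) (u - v) := by
    intro u v
    have hd : ∀ t : ℝ, HasDerivAt (fun t : ℝ => inner ℝ (u - v) (gradient f (v + t • (u - v))))
        (inner ℝ (u - v) (fderiv ℝ (gradient f) (v + t • (u - v)) (u - v))) t := fun t => by
      have h2 := (hg (v + t • (u - v))).hasFDerivAt.comp_hasDerivAt t (hline v (u - v) t)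
      simpa using (hasDerivAt_const t (u - v)).inner ℝ h2
    obtain ⟨t, -, he⟩ := exists_deriv_eq_slope _ zero_lt_one
      (fun t _ => (hd t).continuousAt.continuousWithinAt)
      (fun t _ => (hd t).differentiableAt.differentiableWithinAt)
    rw [(hd t).deriv] at he
    have h2 := hlow (v + t • (u - v)) (u - v)
    rw [he] at h2
    simp only [one_smul, zero_smul, add_zero, sub_zero, div_one, add_sub_cancel] at h2
    rwa [← inner_sub_right, real_inner_comm] at h2
  refine ⟨h1, hL2, fun u v => ?_, hstrong, fun u v => ?_, fun x => ?_⟩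
  · have hd : ∀ t : ℝ, HasDerivAt (fun t : ℝ => f (v + t • (u - v)))
        (inner ℝ (gradient f (v + t • (u - v))) (u - v)) t := fun t => by
      have h2 := (hf (v + t • (u - v))).hasGradientAt.hasFDerivAt.comp_hasDerivAt t
        (hline v (u - v) t)
      exact h2
    obtain ⟨t, ht, he⟩ := exists_deriv_eq_slope _ zero_lt_one
      (fun t _ => (hd t).continuousAt.continuousWithinAt)
      (fun t _ => (hd t).differentiableAt.differentiableWithinAt)
    rw [(hd t).deriv] at he
    simp only [one_smul, zero_smul, add_zero, sub_zero, div_one, add_sub_cancel] at he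
    have h2 := hstrong (v + t • (u - v)) v
    rw [add_sub_cancel_left, inner_smul_right, inner_sub_left] at h2
    have h3 : 0 ≤ t * (inner ℝ (gradient f (v + t • (u - v))) (u - v)
        - inner ℝ (gradient f v) (u - v)) := le_trans (by positivity) h2
    have h4 := nonneg_of_mul_nonneg_right h3 ht.1
    linarith
  · -- polarization bounds the operator norm of the positive semidefinite Hessian by `L₂`
    have hnorm : ∀ x, ‖fderiv ℝ (gradient f) x‖ ≤ L₂ := fun x => by
      set A := fderiv ℝ (gradient f) x with hA
      refine A.opNorm_le_bound hL2.le fun w => ?_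
      have h2 := hupp x (w + (1 / L₂) • A w)
      have h3 := hlow x (w - (1 / L₂) • A w)
      have h4 : 0 ≤ L₁ * ‖w - (1 / L₂) • A w‖ ^ 2 := by positivity
      have h5 : ‖w + (1 / L₂) • A w‖ ≤ ‖w‖ + 1 / L₂ * ‖A w‖ := by
        refine (norm_add_le _ _).trans_eq ?_
        rw [norm_smul, Real.norm_of_nonneg (by positivity)]
      have h6 : L₂ * ‖w + (1 / L₂) • A w‖ ^ 2 ≤ L₂ * (‖w‖ + 1 / L₂ * ‖A w‖) ^ 2 := by gcongr
      have h7 := hsymm x w (A w)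
      rw [← hA] at h2 h3 h7
      simp only [map_add, map_sub, map_smul, inner_add_left, inner_add_right, inner_sub_left,
        inner_sub_right, inner_smul_left, inner_smul_right, conj_trivial,
        real_inner_self_eq_norm_sq] at h2 h3
      rw [real_inner_self_eq_norm_sq] at h7
      rw [← h7] at h2 h3
      have h8 : 4 * (1 / L₂) * ‖A w‖ ^ 2 ≤ L₂ * (‖w‖ + 1 / L₂ * ‖A w‖) ^ 2 := by
        linarith
      have h9 : (2 * ‖A w‖) ^ 2 ≤ (L₂ * ‖w‖ + ‖A w‖) ^ 2 := by
        have := mul_le_mul_of_nonneg_left h8 hL2.le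
        field_simp at this
        nlinarith
      have h10 := abs_le_of_sq_le_sq h9 (by positivity)
      linarith [le_of_abs_le h10]
    exact convex_univ.norm_image_sub_le_of_norm_fderiv_le (fun y _ => hg y) (fun y _ => hnorm y)
      (Set.mem_univ v) (Set.mem_univ u)
  · refine ⟨fderiv ℝ (gradient f) x, hsymm x, |L₃|, abs_nonneg _, fun u v => ?_⟩
    set r := ‖u - x‖ + ‖v - x‖ with hr
    refine (convex_closedBall x r).norm_image_sub_le_of_norm_hasFDerivWithin_le'
      (fun y _ => (hg y).hasFDerivAt.hasFDerivWithinAt) (fun y hy => ?_) ?_ ?_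
    · refine (hlip y x).trans ?_
      rw [mem_closedBall_iff_norm] at hy
      exact mul_le_mul (le_abs_self _) hy (norm_nonneg _) (abs_nonneg _)
    · rw [mem_closedBall_iff_norm, hr]; linarith [norm_nonneg (u - x)]
    · rw [mem_closedBall_iff_norm, hr]; linarith [norm_nonneg (v - x)]

/-! ### Stacked vectors -/

section Stacked

variable {m d : ℕ}

/-- The stacked vector with given blocks. -/
def stack (v : Fin m → Vec d) : Stack m d := WithLp.toLp 2 fun p => v p.1 p.2

@[simp] theorem block_stack (v : Fin m → Vec d) (i : Fin m) : block (stack v) i = v i := rfl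

@[simp] theorem block_add (u v : Stack m d) (i : Fin m) :
    block (u + v) i = block u i + block v i := rfl

@[simp] theorem block_sub (u v : Stack m d) (i : Fin m) :
    block (u - v) i = block u i - block v i := rfl

@[simp] theorem block_smul (c : ℝ) (v : Stack m d) (i : Fin m) :
    block (c • v) i = c • block v i := rfl

theorem inner_eq_sum_block (u v : Stack m d) :
    inner ℝ u v = ∑ i, inner ℝ (block u i) (block v i) := by
  simp only [PiLp.inner_apply, Fintype.sum_prod_type]
  rfl

theorem norm_sq_eq_sum_block (u : Stack m d) : ‖u‖ ^ 2 = ∑ i, ‖block u i‖ ^ 2 := by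
  simp only [← real_inner_self_eq_norm_sq, inner_eq_sum_block]

theorem norm_block_le (u : Stack m d) (i : Fin m) : ‖block u i‖ ≤ ‖u‖ := by
  refine le_of_sq_le_sq ?_ (norm_nonneg _)
  rw [norm_sq_eq_sum_block]
  exact Finset.single_le_sum (f := fun i => ‖block u i‖ ^ 2) (fun _ _ => by positivity)
    (Finset.mem_univ i)

theorem norm_le_sum_block (u : Stack m d) : ‖u‖ ≤ ∑ i, ‖block u i‖ := by
  refine le_of_sq_le_sq ?_ (Finset.sum_nonneg fun _ _ => norm_nonneg _)
  rw [norm_sq_eq_sum_block]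
  exact Finset.sum_sq_le_sq_sum_of_nonneg fun _ _ => norm_nonneg _

theorem RegularConvex.sum_blocks {f : Fin m → Vec d → ℝ} {g : Fin m → Vec d → Vec d} {μ ℓ : ℝ}
    (hμ : 0 < μ) (hℓ : 0 < ℓ) (h : ∀ i, RegularConvex (f i) (g i) μ ℓ) :
    RegularConvex (sumObjective f) (fun x => stack fun i => g i (block x i)) μ ℓ where
  mu_pos := hμ
  lip_pos := hℓ
  subgrad u v := by
    simp only [sumObjective, inner_eq_sum_block, block_stack, block_sub, ← Finset.sum_add_distrib]
    exact Finset.sum_le_sum fun i _ => (h i).subgrad _ _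
  strong u v := by
    simp only [norm_sq_eq_sum_block, inner_eq_sum_block, block_stack, block_sub, Finset.mul_sum]
    exact Finset.sum_le_sum fun i _ => (h i).strong _ _
  lip u v := by
    refine le_of_sq_le_sq ?_ (by positivity)
    simp only [mul_pow, norm_sq_eq_sum_block, block_stack, block_sub, Finset.mul_sum]
    refine Finset.sum_le_sum fun i _ => ?_
    rw [← mul_pow]
    have := (h i).lip (block u i) (block v i)
    gcongr
  hess x := by
    choose A hA C hC hAC using fun i => (h i).hess (block x i)
    refine ⟨LinearMap.toContinuousLinearMap
      { toFun := fun v => stack fun i => A i (block v i)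
        map_add' := fun u v => ?_
        map_smul' := fun c v => ?_ }, fun u v => ?_, ∑ i, C i,
      Finset.sum_nonneg fun i _ => hC i, fun u v => ?_⟩
    · ext p; simp [stack]
    · ext p; simp [stack]
    · simp [inner_eq_sum_block, hA]
    · refine (norm_le_sum_block _).trans ?_
      rw [Finset.sum_mul, Finset.sum_mul]
      refine Finset.sum_le_sum fun i _ => ?_
      have h1 := hAC i (block u i) (block v i)
      simp only [← block_sub] at h1
      refine le_trans h1 ?_
      have := hC i
      gcongr <;> exact norm_block_le _ i

end Stacked

/-! ### The Douglas–Rachford envelope -/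

section Envelope

variable {m d : ℕ}

/-- The orthogonal projection onto the consensus subspace `{y | y_1 = ⋯ = y_m}`, which replaces
every block by the mean of the blocks. -/
noncomputable def consensus (m d : ℕ) : Stack m d →L[ℝ] Stack m d :=
  LinearMap.toContinuousLinearMap
    { toFun := fun y => stack fun _ => (1 / (m : ℝ)) • ∑ i, block y i
      map_add' := fun u v => by
        ext p; simp [stack, Finset.sum_add_distrib]
      map_smul' := fun c v => by
        ext p; simp [stack, ← Finset.smul_sum, mul_left_comm c] }

theorem block_consensus (y : Stack m d) (i : Fin m) :
    block (consensus m d y) i = (1 / (m : ℝ)) • ∑ j, block y j := rfl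

theorem consensus_symm (u v : Stack m d) :
    inner ℝ (consensus m d u) v = inner ℝ u (consensus m d v) := by
  simp only [inner_eq_sum_block, block_consensus, inner_smul_left, inner_smul_right, conj_trivial,
    ← Finset.mul_sum]
  rw [← inner_sum, ← sum_inner]

theorem consensus_idem (hm : 0 < m) (u : Stack m d) :
    consensus m d (consensus m d u) = consensus m d u := by
  have hm' : (m : ℝ) ≠ 0 := by positivity
  have : ∀ i, block (consensus m d (consensus m d u)) i = block (consensus m d u) i := fun i => by
    rw [block_consensus]
    simp only [block_consensus, Finset.sum_const, Finset.card_univ, Fintype.card_fin]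
    rw [← Nat.cast_smul_eq_nsmul ℝ, smul_smul, smul_smul]
    congr 1
    field_simp
  ext p
  exact congrFun (congrArg WithLp.ofLp (this p.1)) p.2

theorem inner_consensus_self (hm : 0 < m) (u : Stack m d) :
    inner ℝ (consensus m d u) u = ‖consensus m d u‖ ^ 2 := by
  rw [← real_inner_self_eq_norm_sq, ← consensus_symm, consensus_idem hm]

theorem norm_consensus_sq (hm : 0 < m) (u : Stack m d) :
    ‖consensus m d u‖ ^ 2 = 1 / m * ‖∑ i, block u i‖ ^ 2 := by
  have hm' : (m : ℝ) ≠ 0 := by positivity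
  rw [norm_sq_eq_sum_block]
  simp only [block_consensus, norm_smul, Finset.sum_const, Finset.card_univ, Fintype.card_fin,
    nsmul_eq_mul, mul_pow]
  rw [Real.norm_of_nonneg (by positivity)]
  field_simp

theorem norm_consensus_le (hm : 0 < m) (u : Stack m d) : ‖consensus m d u‖ ≤ ‖u‖ := by
  have h1 := inner_consensus_self hm u
  have h2 := real_inner_le_norm (consensus m d u) u
  rcases (norm_nonneg (consensus m d u)).eq_or_lt with h0 | h0
  · rw [← h0]; positivity
  · nlinarith

/-- The minimizer in the definition of `h₂^γ` is `z = y - P y / 4`, with `P` the projection onto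
consensus. The value `γ = λ / (3m)` enters here. -/
theorem moreau_h₂ (hm : 0 < m) {lam γ : ℝ} (hlam : 0 < lam) (hγ : γ = lam / (3 * m))
    (y : Stack m d) : moreau γ (h₂ lam) y = 1 / (8 * γ) * ‖consensus m d y‖ ^ 2 := by
  have hm' : (0 : ℝ) < m := by positivity
  have hγ0 : 0 < γ := by rw [hγ]; positivity
  have hh : ∀ z : Stack m d, h₂ lam z = 1 / (6 * γ) * ‖consensus m d z‖ ^ 2 := fun z => by
    rw [h₂, norm_consensus_sq hm, hγ]
    field_simp
    ring
  refine IsLeast.csInf_eq ⟨⟨y - (1 / 4 : ℝ) • consensus m d y, ?_⟩, ?_⟩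
  · simp only [hh, map_sub, map_smul, consensus_idem hm, sub_sub_cancel, norm_smul]
    rw [show consensus m d y - (1 / 4 : ℝ) • consensus m d y = (3 / 4 : ℝ) • consensus m d y by
      module, norm_smul]
    norm_num
    field_simp
    ring
  · rintro _ ⟨z, rfl⟩
    simp only [hh]
    have h1 := norm_consensus_le hm (y - z)
    have h2 : ‖consensus m d (y - z)‖ ^ 2 ≤ ‖y - z‖ ^ 2 := by gcongr
    have h3 : ‖consensus m d y‖ - ‖consensus m d z‖ ≤ ‖consensus m d (y - z)‖ := by
      rw [map_sub]; exact norm_sub_norm_le _ _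
    have h4 : ‖consensus m d z‖ - ‖consensus m d y‖ ≤ ‖consensus m d (y - z)‖ := by
      rw [map_sub, ← norm_sub_rev]; exact norm_sub_norm_le _ _
    have h5 : (‖consensus m d y‖ - ‖consensus m d z‖) ^ 2 ≤ ‖y - z‖ ^ 2 :=
      (sq_le_sq' (by linarith) h3).trans h2
    rw [← sub_nonneg]
    have e : 1 / (6 * γ) * ‖consensus m d z‖ ^ 2 + 1 / (2 * γ) * ‖y - z‖ ^ 2
        - 1 / (8 * γ) * ‖consensus m d y‖ ^ 2 = 1 / γ * (1 / 6 * ‖consensus m d z‖ ^ 2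
          + 1 / 2 * ‖y - z‖ ^ 2 - 1 / 8 * ‖consensus m d y‖ ^ 2) := by
      field_simp
    rw [e]
    apply mul_nonneg (by positivity)
    nlinarith [sq_nonneg (‖consensus m d z‖ - 3 / 4 * ‖consensus m d y‖)]

theorem gradient_moreau_h₂ (hm : 0 < m) {lam γ : ℝ} (hlam : 0 < lam) (hγ : γ = lam / (3 * m))
    (y : Stack m d) : gradient (moreau γ (h₂ lam)) y = (1 / (4 * γ)) • consensus m d y := by
  have hγ0 : 0 < γ := by rw [hγ]; positivity
  refine HasGradientAt.gradient (hasGradientAt_of_subgradient (g := fun y =>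
    (1 / (4 * γ)) • consensus m d y) (fun u v => ?_) (by fun_prop) y)
  rw [moreau_h₂ hm hlam hγ, moreau_h₂ hm hlam hγ, inner_smul_left, conj_trivial, inner_sub_right,
    inner_consensus_self hm]
  have h1 : inner ℝ (consensus m d v) u = inner ℝ (consensus m d v) (consensus m d u) := by
    rw [← consensus_symm, consensus_idem hm]
  rw [h1]
  have h2 := norm_sub_sq_real (consensus m d u) (consensus m d v)
  rw [real_inner_comm] at h2
  have h3 : 0 ≤ 1 / (8 * γ) * ‖consensus m d u - consensus m d v‖ ^ 2 := by positivity
  rw [h2] at h3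
  have e : 1 / (4 * γ) = 2 * (1 / (8 * γ)) := by field_simp; norm_num
  rw [e]
  nlinarith

theorem conjugate_of_grad {F : Stack m d → ℝ} {g : Stack m d → Stack m d} {μ ℓ : ℝ}
    (h : RegularConvex F g μ ℓ) (x : Stack m d) :
    conjugate F (g x) = inner ℝ (g x) x - F x := by
  refine IsGreatest.csSup_eq ⟨⟨x, rfl⟩, ?_⟩
  rintro _ ⟨z, rfl⟩
  have := h.subgrad z x
  rw [inner_sub_right] at this
  simp only
  linarith

/-- Fenchel's inequality. The supremum that defines `conjugate F u` is over a bounded set, because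
`F - ⟨u, ·⟩` has a minimizer. -/
theorem le_conjugate {F : Stack m d → ℝ} {g : Stack m d → Stack m d} {μ ℓ : ℝ}
    (h : RegularConvex F g μ ℓ) (u x : Stack m d) : inner ℝ u x - F x ≤ conjugate F u := by
  obtain ⟨x₀, hx₀, hmin⟩ := (h.add_linear (-u)).exists_grad_eq_zero
  refine le_ciSup (f := fun x => inner ℝ u x - F x) ⟨inner ℝ u x₀ - F x₀, ?_⟩ x
  rintro _ ⟨z, rfl⟩
  have := hmin z
  simp only [inner_neg_left] at this ⊢
  linarith

/-- Fenchel duality for the Moreau envelope of `F⋆(-·)`: it equals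
`-(min_x {F x + γ/2 ‖x‖² + ⟨w, x⟩})`. The infimum over `z` is attained at `z = w + γ x`. -/
theorem moreau_conjugate {F : Stack m d → ℝ} {g : Stack m d → Stack m d} {μ ℓ γ : ℝ}
    (hγ : 0 < γ) (h : RegularConvex F g μ ℓ) {w x : Stack m d} (hx : g x + γ • x = -w) :
    moreau γ (fun z => conjugate F (-z)) w
      = -(F x + γ / 2 * inner ℝ x x + inner ℝ w x) := by
  have hgx : g x = -(w + γ • x) := by rw [neg_add, ← hx]; abel
  refine IsLeast.csInf_eq ⟨⟨w + γ • x, ?_⟩, ?_⟩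
  · simp only
    rw [← hgx, conjugate_of_grad h, hgx, sub_add_cancel_left, norm_neg, norm_smul,
      Real.norm_of_nonneg hγ.le, mul_pow, ← real_inner_self_eq_norm_sq, inner_neg_left,
      inner_add_left, inner_smul_left, conj_trivial]
    field_simp
    ring
  · rintro _ ⟨z, rfl⟩
    have h1 := le_conjugate h (-z) x
    have h2 : 0 ≤ 1 / (2 * γ) * ‖(w - z) + γ • x‖ ^ 2 := by positivity
    rw [norm_add_sq_real, norm_smul, Real.norm_of_nonneg hγ.le, mul_pow,
      ← real_inner_self_eq_norm_sq x, inner_smul_right, inner_sub_left] at h2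
    rw [inner_neg_left] at h1
    simp only
    have e : 1 / (2 * γ) * (‖w - z‖ ^ 2 + 2 * (γ * (inner ℝ w x - inner ℝ z x))
        + γ ^ 2 * inner ℝ x x) = 1 / (2 * γ) * ‖w - z‖ ^ 2 + (inner ℝ w x - inner ℝ z x)
          + γ / 2 * inner ℝ x x := by
      field_simp
    rw [e] at h2
    linarith

/-- The envelope in closed form is `‖P y‖² / (16γ) + h₁^γ(y - P y / 2)`; it is therefore strongly
convex, with gradient Lipschitz constant at most `1 / γ` in the monotone sense. -/
theorem envelope_regular (hm : 0 < m) {f : Fin m → Vec d → ℝ} (hf1 : Assumption1 f)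
    (hf2 : Assumption2 f) {lam γ : ℝ} (hlam : 0 < lam) (hγ : γ = lam / (3 * m)) :
    ∃ μ ℓ, RegularConvex (envelope f lam γ) (gradient (envelope f lam γ)) μ ℓ ∧
      ∀ u v, inner ℝ (gradient (envelope f lam γ) u - gradient (envelope f lam γ) v) (u - v)
        ≤ 1 / γ * ‖u - v‖ ^ 2 := by
  have hm' : (0 : ℝ) < m := by positivity
  have hγ0 : 0 < γ := by rw [hγ]; positivity
  obtain ⟨hd, L₁, L₂, hL1, hL12, hb⟩ := hf1
  obtain ⟨L₃, hL3⟩ := hf2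
  have hF := RegularConvex.sum_blocks hL1 (hL1.trans_le hL12) fun i =>
    RegularConvex.of_hessian (hd i).1 (hd i).2 hL1 hL12 (fun x v => (hb i x v).1)
      (fun x v => (hb i x v).2) (hL3 i)
  set gF : Stack m d → Stack m d := fun x => stack fun i => gradient (f i) (block x i)
  have hΦ : RegularConvex (fun x => sumObjective f x + γ / 2 * inner ℝ x x)
      (fun x => gF x + γ • x) (L₁ + γ) (L₂ + γ * ‖ContinuousLinearMap.id ℝ (Stack m d)‖) := by
    have h1 := hF.add_quadratic hγ0.le (Q := ContinuousLinearMap.id ℝ (Stack m d))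
      (fun u v => rfl) (fun u => real_inner_self_nonneg)
    refine ⟨by positivity, h1.lip_pos, h1.subgrad, fun u v => ?_, h1.lip, h1.hess⟩
    have h2 := hF.strong u v
    rw [add_sub_add_comm, ← smul_sub, inner_add_left, inner_smul_left, conj_trivial,
      real_inner_self_eq_norm_sq]
    linarith
  obtain ⟨X, hX, hG, hGup⟩ := hΦ.conjugate
  set P := consensus m d with hP
  set R : Stack m d →L[ℝ] Stack m d := ContinuousLinearMap.id ℝ _ - (1 / 2 : ℝ) • P with hR
  have hRapp : ∀ u, R u = u - (1 / 2 : ℝ) • P u := fun u => rfl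
  have hRs : ∀ u v, inner ℝ (R u) v = inner ℝ u (R v) := fun u v => by
    rw [hRapp, hRapp, inner_sub_left, inner_sub_right, inner_smul_left, inner_smul_right,
      consensus_symm, conj_trivial]
  have hRn : ∀ u, ‖R u‖ ^ 2 = ‖u‖ ^ 2 - 3 / 4 * ‖P u‖ ^ 2 := fun u => by
    rw [hRapp, norm_sub_sq_real, inner_smul_right, real_inner_comm, inner_consensus_self hm,
      norm_smul]
    norm_num
    ring
  have hRlow : ∀ u, 1 / 2 * ‖u‖ ≤ ‖R u‖ := fun u => by
    refine le_of_sq_le_sq ?_ (norm_nonneg _)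
    have : ‖P u‖ ^ 2 ≤ ‖u‖ ^ 2 := by
      have := norm_consensus_le hm u
      gcongr
    rw [hRn]
    nlinarith
  have hH := (hG.comp_symmetric (by norm_num : (0 : ℝ) < 1 / 2) hRs hRlow).add_quadratic
    (c := 1 / (8 * γ)) (by positivity) consensus_symm (fun u => by
      rw [inner_consensus_self hm]; positivity)
  have henv : envelope f lam γ = fun u => (-(sumObjective f (X (R u))
      + γ / 2 * inner ℝ (X (R u)) (X (R u)) + inner ℝ (R u) (X (R u))))
      + 1 / (8 * γ) / 2 * inner ℝ (P u) u := by
    funext u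
    have h1 : u - (2 * γ) • gradient (moreau γ (h₂ lam)) u = R u := by
      rw [gradient_moreau_h₂ hm hlam hγ, smul_smul, hRapp]
      congr 2
      field_simp
      norm_num
    rw [envelope, h1, moreau_h₂ hm hlam hγ, gradient_moreau_h₂ hm hlam hγ,
      show h₁ f = fun z => conjugate (sumObjective f) (-z) from rfl,
      moreau_conjugate hγ0 hF (hX (R u)), inner_consensus_self hm, norm_smul,
      Real.norm_of_nonneg (by positivity), ← hP]
    field_simp
    ring
  rw [← henv] at hH
  have hgrad : gradient (envelope f lam γ) = fun u => R (-X (R u)) + (1 / (8 * γ)) • P u :=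
    funext fun u => (hH.hasGradientAt u).gradient
  rw [hgrad]
  refine ⟨_, _, hH, fun u v => ?_⟩
  have e : R (-X (R u)) + (1 / (8 * γ)) • P u - (R (-X (R v)) + (1 / (8 * γ)) • P v)
      = R (-X (R u) - -X (R v)) + (1 / (8 * γ)) • P (u - v) := by
    rw [map_sub, map_sub]; module
  rw [e, inner_add_left, hRs, map_sub R u v, inner_smul_left, conj_trivial,
    inner_consensus_self hm, ← hP]
  have h1 := hGup (R u) (R v)
  have h2 : 1 / (L₁ + γ) * ‖R u - R v‖ ^ 2 ≤ 1 / γ * ‖R u - R v‖ ^ 2 := by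
    gcongr; linarith
  have h3 := hRn (u - v)
  rw [map_sub R] at h3
  rw [h3] at h2
  have e2 : 1 / (8 * γ) = 1 / γ * (1 / 8) := by field_simp
  have h4 : 0 ≤ 1 / γ * ‖P (u - v)‖ ^ 2 := by positivity
  rw [h3] at h1
  rw [e2]
  nlinarith

end Envelope

/-! ### The BFGS update of the inverse -/

section Matrices

variable {m d : ℕ}

theorem act_add (W : Mat m d) (u v : Stack m d) : act W (u + v) = act W u + act W v :=
  map_add (Matrix.toEuclideanLin W) u v

theorem act_sub (W : Mat m d) (u v : Stack m d) : act W (u - v) = act W u - act W v :=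
  map_sub (Matrix.toEuclideanLin W) u v

theorem act_smul (W : Mat m d) (c : ℝ) (v : Stack m d) : act W (c • v) = c • act W v :=
  map_smul (Matrix.toEuclideanLin W) c v

theorem act_zero (W : Mat m d) : act W (0 : Stack m d) = 0 :=
  map_zero (Matrix.toEuclideanLin W)

theorem add_act (A B : Mat m d) (v : Stack m d) : act (A + B) v = act A v + act B v := by
  simp [act, Matrix.add_mulVec]

theorem sub_act (A B : Mat m d) (v : Stack m d) : act (A - B) v = act A v - act B v := by
  simp [act, Matrix.sub_mulVec]

theorem smul_act (c : ℝ) (A : Mat m d) (v : Stack m d) : act (c • A) v = c • act A v := by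
  simp [act, Matrix.smul_mulVec]

theorem one_act (v : Stack m d) : act (1 : Mat m d) v = v := by
  simp [act]

theorem mul_act (A B : Mat m d) (v : Stack m d) : act (A * B) v = act A (act B v) := by
  simp [act, Matrix.mulVec_mulVec]

theorem outer_act (u v x : Stack m d) : act (outer u v) x = (inner ℝ v x : ℝ) • u := by
  ext i
  simp [act, outer, Matrix.vecMulVec_mulVec, EuclideanSpace.inner_eq_star_dotProduct,
    dotProduct_comm]

theorem eq_of_act_eq {A B : Mat m d} (h : ∀ v, act A v = act B v) : A = B :=
  Matrix.toEuclideanLin.injective (LinearMap.ext h)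

theorem inner_eq_dotProduct (u v : Stack m d) : inner ℝ u v = u.ofLp ⬝ᵥ v.ofLp := by
  rw [EuclideanSpace.inner_eq_star_dotProduct, star_trivial, dotProduct_comm]

theorem posDef_iff_act {W : Mat m d} : W.PosDef ↔
    (∀ u v, inner ℝ (act W u) v = inner ℝ u (act W v)) ∧ ∀ v, v ≠ 0 → 0 < inner ℝ v (act W v) := by
  rw [Matrix.posDef_iff_dotProduct_mulVec]
  refine and_congr ⟨fun h u v => ?_, fun h => ?_⟩ ⟨fun h v hv => ?_, fun h v hv => ?_⟩
  · have hT : Matrix.transpose W = W := by simpa [Matrix.IsHermitian] using h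
    rw [inner_eq_dotProduct, inner_eq_dotProduct]
    change W.mulVec u.ofLp ⬝ᵥ v.ofLp = u.ofLp ⬝ᵥ W.mulVec v.ofLp
    rw [Matrix.dotProduct_mulVec, ← Matrix.mulVec_transpose, hT]
  · ext i j
    have := h (EuclideanSpace.single i 1) (EuclideanSpace.single j 1)
    simpa [inner_eq_dotProduct, act] using this
  · rw [inner_eq_dotProduct]
    simpa [act] using h (x := v.ofLp) (fun h0 => hv (by ext i; exact congrFun h0 i))
  · have := h (WithLp.toLp 2 v) (fun h0 => hv (congrArg WithLp.ofLp h0))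
    rw [inner_eq_dotProduct] at this
    simpa [act] using this

variable {W : Mat m d}

theorem act_inv_act (hW : W.PosDef) (v : Stack m d) : act W⁻¹ (act W v) = v := by
  rw [← mul_act, Matrix.nonsing_inv_mul _ hW.det_pos.ne'.isUnit, one_act]

theorem act_act_inv (hW : W.PosDef) (v : Stack m d) : act W (act W⁻¹ v) = v := by
  rw [← mul_act, Matrix.mul_nonsing_inv _ hW.det_pos.ne'.isUnit, one_act]

theorem bfgsUpdate_act (W : Mat m d) (s z v : Stack m d) : act (bfgsUpdate W s z) v
    = act W v + ((inner ℝ s z + inner ℝ z (act W z)) / (inner ℝ s z) ^ 2 * inner ℝ s v) • s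
      - (1 / inner ℝ s z : ℝ) • ((inner ℝ s v : ℝ) • act W z + (inner ℝ z (act W v) : ℝ) • s) := by
  simp only [bfgsUpdate, sub_act, add_act, smul_act, mul_act, outer_act, act_smul, smul_smul]

/-- With `V = I - z sᵀ / (sᵀz)`, the updated form is `vᵀW⁺v = (Vv)ᵀW(Vv) + (sᵀv)² / (sᵀz)`. -/
theorem bfgsUpdate_posDef (hW : W.PosDef) {s z : Stack m d} (hsz : 0 < (inner ℝ s z : ℝ)) :
    (bfgsUpdate W s z).PosDef := by
  obtain ⟨hsym, hpos⟩ := posDef_iff_act.1 hW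
  refine posDef_iff_act.2 ⟨fun u v => ?_, fun v hv => ?_⟩
  · simp only [bfgsUpdate_act, inner_add_left, inner_sub_left, inner_add_right, inner_sub_right,
      inner_smul_left, inner_smul_right, conj_trivial, hsym]
    rw [real_inner_comm s u, show inner ℝ z (act W u) = inner ℝ u (act W z) by
      rw [← hsym z u, real_inner_comm]]
    ring
  · set t : ℝ := inner ℝ s z with ht
    set V : Stack m d := v - (inner ℝ s v / t) • z with hV
    have e : inner ℝ v (act (bfgsUpdate W s z) v) = inner ℝ V (act W V) + (inner ℝ s v) ^ 2 / t := by
      rw [bfgsUpdate_act, hV]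
      simp only [act_sub, act_smul, inner_add_right, inner_sub_left, inner_sub_right,
        inner_smul_left, inner_smul_right, conj_trivial, ← ht]
      rw [real_inner_comm s v, ← hsym v z, real_inner_comm z (act W v)]
      field_simp
      ring
    rw [e]
    by_cases h0 : V = 0
    · have h1 : (inner ℝ s v : ℝ) ≠ 0 := fun h1 => hv (by rw [hV, h1] at h0; simpa using h0)
      rw [h0, inner_zero_left]
      positivity
    · have := hpos V h0
      positivity

/-- The BFGS update of the matrix `B` itself. -/
noncomputable def bfgsDirect (B : Mat m d) (s z : Stack m d) : Mat m d :=
  B + (1 / inner ℝ s z : ℝ) • outer z z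
    - (1 / inner ℝ s (act B s) : ℝ) • outer (act B s) (act B s)

theorem bfgsDirect_act (B : Mat m d) (s z x : Stack m d) : act (bfgsDirect B s z) x
    = act B x + (1 / inner ℝ s z * inner ℝ z x : ℝ) • z
      - (1 / inner ℝ s (act B s) * inner ℝ (act B s) x : ℝ) • act B s := by
  simp only [bfgsDirect, sub_act, add_act, smul_act, outer_act, smul_smul]

theorem bfgsUpdate_inv (hW : W.PosDef) {s z : Stack m d} (hsz : 0 < (inner ℝ s z : ℝ)) :
    (bfgsUpdate W s z)⁻¹ = bfgsDirect W⁻¹ s z := by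
  obtain ⟨hsym, hpos⟩ := posDef_iff_act.1 hW.inv
  have hs : s ≠ 0 := fun h => by rw [h, inner_zero_left] at hsz; exact lt_irrefl _ hsz
  have hb := hpos s hs
  refine Matrix.inv_eq_right_inv (eq_of_act_eq fun x => ?_)
  rw [mul_act, one_act, bfgsDirect_act, bfgsUpdate_act]
  simp only [act_add, act_sub, act_smul, act_act_inv hW, inner_add_right, inner_sub_right,
    inner_smul_right]
  rw [hsym s x, real_inner_comm s z]
  set t : ℝ := inner ℝ s z
  set b : ℝ := inner ℝ s (act W⁻¹ s)
  set w : ℝ := inner ℝ z (act W z)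
  set β : ℝ := inner ℝ s (act W⁻¹ x)
  set ζ : ℝ := inner ℝ z x
  have htne : t ≠ 0 := hsz.ne'
  have hbne : b ≠ 0 := hb.ne'
  match_scalars <;> field_simp <;> ring

/-- The update is `B (1 + U V)` with factors of rank two, so its determinant reduces to that of a
`2 × 2` matrix. -/
theorem det_bfgsDirect (hW : W.PosDef) {s z : Stack m d} (hsz : 0 < (inner ℝ s z : ℝ)) :
    (bfgsDirect W⁻¹ s z).det = W⁻¹.det * (inner ℝ s z / inner ℝ s (act W⁻¹ s)) := by
  obtain ⟨hsym, hpos⟩ := posDef_iff_act.1 hW.inv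
  have hs : s ≠ 0 := fun h => by rw [h, inner_zero_left] at hsz; exact lt_irrefl _ hsz
  have hb := hpos s hs
  set t : ℝ := inner ℝ s z with ht
  set b : ℝ := inner ℝ s (act W⁻¹ s) with hbdef
  set U : Matrix (Fin m × Fin d) (Fin 2) ℝ :=
    Matrix.of fun i j => ![1 / t * act W z i, -(1 / b) * s i] j with hU
  set V : Matrix (Fin 2) (Fin m × Fin d) ℝ :=
    Matrix.of fun j i => ![z i, act W⁻¹ s i] j with hV
  have hUV : U * V = (1 / t) • outer (act W z) z - (1 / b) • outer s (act W⁻¹ s) := by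
    ext i j
    simp [hU, hV, Matrix.mul_apply, Fin.sum_univ_two, outer, Matrix.vecMulVec]
    ring
  have hfac : bfgsDirect W⁻¹ s z = W⁻¹ * (1 + U * V) := by
    refine eq_of_act_eq fun x => ?_
    rw [hUV, bfgsDirect_act, mul_act]
    simp only [add_act, sub_act, one_act, smul_act, outer_act, act_add, act_sub, act_smul,
      act_inv_act hW, smul_smul, ← ht, ← hbdef]
    abel
  have hsum : ∀ u v : Stack m d, ∑ i, u i * v i = inner ℝ u v := fun u v => by
    rw [inner_eq_dotProduct]; rfl
  have h1 : ∀ (c : ℝ) (u v : Stack m d), ∑ i, u i * (c * v i) = c * inner ℝ u v := fun c u v => by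
    rw [← hsum, Finset.mul_sum]
    exact Finset.sum_congr rfl fun i _ => by ring
  rw [hfac, Matrix.det_mul, Matrix.det_one_add_mul_comm, Matrix.det_fin_two]
  congr 1
  simp only [Matrix.add_apply, Matrix.mul_apply, hU, hV, Matrix.of_apply, Matrix.cons_val_zero,
    Matrix.cons_val_one, Matrix.one_apply_eq, h1]
  rw [show inner ℝ (act W⁻¹ s) (act W z) = t by rw [hsym, act_inv_act hW],
    show inner ℝ (act W⁻¹ s) s = b from hsym s s, real_inner_comm s z, ← ht,
    Matrix.one_apply_ne zero_ne_one, Matrix.one_apply_ne one_ne_zero]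
  have htne : t ≠ 0 := hsz.ne'
  have hbne : b ≠ 0 := hb.ne'
  field_simp
  ring

theorem trace_mul_outer (K : Mat m d) (u v : Stack m d) :
    (K * outer u v).trace = inner ℝ v (act K u) := by
  rw [outer, Matrix.mul_vecMulVec, Matrix.trace_vecMulVec, inner_eq_dotProduct, dotProduct_comm]
  rfl

/-! ### The potential of Byrd and Nocedal -/

/-- The potential `tr(K B) - log det B`. For `K = G⁻¹` it is, up to a constant, the function
`tr(X) - log det X` at `X = G^{-1/2} B G^{-1/2}`, written without a square root. -/
noncomputable def potential (K B : Mat m d) : ℝ := (K * B).trace - Real.log B.det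

theorem potential_bfgsUpdate (K : Mat m d) (hW : W.PosDef) {s z : Stack m d}
    (hsz : 0 < (inner ℝ s z : ℝ)) :
    potential K (bfgsUpdate W s z)⁻¹ = potential K W⁻¹
      + (inner ℝ z (act K z) / inner ℝ s z - Real.log (inner ℝ s z))
      - (inner ℝ (act W⁻¹ s) (act K (act W⁻¹ s)) / inner ℝ s (act W⁻¹ s)
        - Real.log (inner ℝ s (act W⁻¹ s))) := by
  obtain ⟨hsym, hpos⟩ := posDef_iff_act.1 hW.inv
  have hs : s ≠ 0 := fun h => by rw [h, inner_zero_left] at hsz; exact lt_irrefl _ hsz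
  have hb := hpos s hs
  rw [bfgsUpdate_inv hW hsz, potential, potential, det_bfgsDirect hW hsz,
    Real.log_mul hW.inv.det_pos.ne' (by positivity), Real.log_div hsz.ne' hb.ne', bfgsDirect,
    Matrix.mul_sub, Matrix.mul_add, Matrix.mul_smul, Matrix.mul_smul, Matrix.trace_sub,
    Matrix.trace_add, Matrix.trace_smul, Matrix.trace_smul, trace_mul_outer, trace_mul_outer,
    smul_eq_mul, smul_eq_mul]
  ring

theorem exists_eigenbasis {B : Mat m d} (hB : B.PosDef) :
    ∃ (b : OrthonormalBasis (Fin m × Fin d) ℝ (Stack m d)) (e : Fin m × Fin d → ℝ),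
      (∀ i, 0 < e i) ∧ (∀ i, act B (b i) = e i • b i) ∧ B.det = ∏ i, e i := by
  refine ⟨hB.1.eigenvectorBasis, hB.1.eigenvalues, hB.eigenvalues_pos, fun i => ?_, ?_⟩
  · ext j
    exact congrFun (hB.1.mulVec_eigenvectorBasis i) j
  · simpa using hB.1.det_eq_prod_eigenvalues

/-- In an eigenbasis of `B` the potential is bounded below by a sum over the eigenvalues, although
`K` need not commute with `B`. -/
theorem sum_le_potential {K B : Mat m d} {κ : ℝ} (hK : ∀ v, κ * ‖v‖ ^ 2 ≤ inner ℝ v (act K v))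
    {b : OrthonormalBasis (Fin m × Fin d) ℝ (Stack m d)} {e : Fin m × Fin d → ℝ}
    (he : ∀ i, 0 < e i) (hb : ∀ i, act B (b i) = e i • b i) (hdet : B.det = ∏ i, e i) :
    ∑ i, (κ * e i - Real.log (e i)) ≤ potential K B := by
  have hsum : ∀ (c : Fin m × Fin d → Mat m d) v, act (∑ i, c i) v = ∑ i, act (c i) v := by
    intro c v
    simp only [act, Matrix.sum_mulVec, ← WithLp.toLp_sum]
  have hBsum : B = ∑ i, e i • outer (b i) (b i) := by
    refine Matrix.toEuclideanLin.injective (b.toBasis.ext fun j => ?_)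
    change act B (b.toBasis j) = act _ (b.toBasis j)
    rw [b.coe_toBasis, hb, hsum]
    simp only [smul_act, outer_act, b.inner_eq_ite]
    simp
  have htr : (K * B).trace = ∑ i, e i * inner ℝ (b i) (act K (b i)) := by
    conv_lhs => rw [hBsum]
    simp only [Matrix.mul_sum, Matrix.trace_sum, Matrix.mul_smul, Matrix.trace_smul,
      trace_mul_outer, smul_eq_mul]
  rw [potential, htr, hdet, Real.log_prod (fun i _ => (he i).ne'), ← Finset.sum_sub_distrib]
  refine Finset.sum_le_sum fun i _ => ?_
  have h1 := hK (b i)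
  rw [b.norm_eq_one] at h1
  nlinarith [he i]

theorem one_add_log_le {κ x : ℝ} (hκ : 0 < κ) (hx : 0 < x) :
    1 + Real.log κ ≤ κ * x - Real.log x := by
  have := Real.log_le_sub_one_of_pos (mul_pos hκ hx)
  rw [Real.log_mul hκ.ne' hx.ne'] at this
  linarith

theorem exists_le_potential {K : Mat m d} {κ : ℝ} (hκ : 0 < κ)
    (hK : ∀ v, κ * ‖v‖ ^ 2 ≤ inner ℝ v (act K v)) : ∃ c, ∀ B : Mat m d, B.PosDef →
      c ≤ potential K B := by
  refine ⟨∑ _i : Fin m × Fin d, (1 + Real.log κ), fun B hB => ?_⟩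
  obtain ⟨b, e, he, hb, hdet⟩ := exists_eigenbasis hB
  exact (Finset.sum_le_sum fun i _ => one_add_log_le hκ (he i)).trans
    (sum_le_potential hK he hb hdet)

/-- On a sublevel set of the potential the eigenvalues are bounded above and away from zero. -/
theorem exists_bounds_of_potential_le {K : Mat m d} {κ : ℝ} (hκ : 0 < κ)
    (hK : ∀ v, κ * ‖v‖ ^ 2 ≤ inner ℝ v (act K v)) (C : ℝ) :
    ∃ a b, 0 < a ∧ 0 < b ∧ ∀ B : Mat m d, B.PosDef → potential K B ≤ C →
      ∀ v, a * ‖v‖ ≤ ‖act B v‖ ∧ ‖act B v‖ ≤ b * ‖v‖ := by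
  set D : ℝ := C - ∑ _i : Fin m × Fin d, (1 + Real.log κ) with hD
  refine ⟨Real.exp (-1 - D) / κ, 2 * (1 + |D|) / κ, by positivity, by positivity,
    fun B hB hC v => ?_⟩
  obtain ⟨b, e, he, hb, hdet⟩ := exists_eigenbasis hB
  have hterm : ∀ i, κ * e i - 1 - Real.log (κ * e i) ≤ D := fun i => by
    have h1 := sum_le_potential hK he hb hdet
    have h2 := Finset.single_le_sum (s := Finset.univ)
      (f := fun i => κ * e i - Real.log (e i) - (1 + Real.log κ))
      (fun i _ => sub_nonneg.2 (one_add_log_le hκ (he i))) (Finset.mem_univ i)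
    rw [Finset.sum_sub_distrib] at h2
    rw [Real.log_mul hκ.ne' (he i).ne']
    linarith
  have hlow : ∀ i, Real.exp (-1 - D) / κ ≤ e i := fun i => by
    have hp : 0 < κ * e i := mul_pos hκ (he i)
    rw [div_le_iff₀ hκ, mul_comm, ← Real.le_log_iff_exp_le hp]
    linarith [hterm i]
  have hupp : ∀ i, e i ≤ 2 * (1 + |D|) / κ := fun i => by
    have hp : 0 < κ * e i := mul_pos hκ (he i)
    have h1 := Real.log_le_sub_one_of_pos (half_pos hp)
    rw [Real.log_div hp.ne' two_ne_zero] at h1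
    have h2 := Real.log_le_sub_one_of_pos (zero_lt_two (α := ℝ))
    rw [le_div_iff₀ hκ]
    linarith [hterm i, le_abs_self D]
  have hcoef : ∀ i, ‖inner ℝ (b i) (act B v)‖ ^ 2 = e i ^ 2 * ‖inner ℝ (b i) v‖ ^ 2 := fun i => by
    rw [← (posDef_iff_act.1 hB).1, hb, inner_smul_left, conj_trivial, norm_mul, mul_pow,
      Real.norm_eq_abs (e i), sq_abs]
  constructor <;> refine le_of_sq_le_sq ?_ (by positivity)
  · rw [mul_pow, ← b.sum_sq_norm_inner_right v, ← b.sum_sq_norm_inner_right (act B v),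
      Finset.mul_sum]
    refine Finset.sum_le_sum fun i _ => ?_
    rw [hcoef]
    have := hlow i
    gcongr
  · rw [mul_pow, ← b.sum_sq_norm_inner_right v, ← b.sum_sq_norm_inner_right (act B v),
      Finset.mul_sum]
    refine Finset.sum_le_sum fun i _ => ?_
    rw [hcoef]
    have := hupp i
    have := (he i).le
    gcongr

end Matrices

/-! ### The potential along a BFGS step -/

section Ratios

variable {m d : ℕ}

/-- `A` is a symmetric operator with `μ ≤ A ≤ Λ`, and the matrix `K` is its inverse, bounded below
by `κ`. The operator `A` is the Hessian at the minimizer. -/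
structure InversePair (A : Stack m d →L[ℝ] Stack m d) (K : Mat m d) (μ κ Λ : ℝ) : Prop where
  mu_pos : 0 < μ
  kappa_pos : 0 < κ
  lam_pos : 0 < Λ
  symm : ∀ u v, inner ℝ (A u) v = inner ℝ u (A v)
  coercive : ∀ v, μ * ‖v‖ ^ 2 ≤ inner ℝ v (A v)
  bound : ∀ v, ‖A v‖ ≤ Λ * ‖v‖
  inv : ∀ v, act K (A v) = v
  symm_inv : ∀ u v, inner ℝ (act K u) v = inner ℝ u (act K v)
  coercive_inv : ∀ v, κ * ‖v‖ ^ 2 ≤ inner ℝ v (act K v)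
  upper_inv : ∀ v, inner ℝ v (act K v) ≤ 1 / μ * ‖v‖ ^ 2

theorem exists_inversePair {A : Stack m d →L[ℝ] Stack m d} {μ : ℝ} (hμ : 0 < μ)
    (hA : ∀ u v, inner ℝ (A u) v = inner ℝ u (A v)) (hpos : ∀ v, μ * ‖v‖ ^ 2 ≤ inner ℝ (A v) v) :
    ∃ (K : Mat m d) (κ Λ : ℝ), InversePair A K μ κ Λ := by
  obtain ⟨T, hAT, hTA, hTs, hTn⟩ := exists_symmetric_inverse hμ hA hpos
  have hK : ∀ v, act (Matrix.toEuclideanLin.symm (T : Stack m d →ₗ[ℝ] Stack m d)) v = T v :=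
    fun v => by
      change Matrix.toEuclideanLin (Matrix.toEuclideanLin.symm _) v = T v
      rw [LinearEquiv.apply_symm_apply]
      rfl
  have hΛ : 0 < ‖A‖ + 1 := by positivity
  have hb : ∀ v, ‖A v‖ ≤ (‖A‖ + 1) * ‖v‖ := fun v => (A.le_opNorm v).trans (by gcongr; linarith)
  refine ⟨_, μ / (‖A‖ + 1) ^ 2, ‖A‖ + 1, hμ, by positivity, hΛ, hA,
    fun v => by rw [← hA]; exact hpos v, hb, fun v => by rw [hK, hTA],
    fun u v => by rw [hK, hK, hTs], fun v => ?_, fun v => ?_⟩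
  · rw [hK]
    have h1 := hpos (T v)
    have h2 := hb (T v)
    rw [hAT] at h1 h2
    refine le_trans ?_ h1
    rw [div_mul_eq_mul_div, div_le_iff₀ (by positivity), mul_assoc, mul_comm (‖T v‖ ^ 2), ← mul_pow]
    gcongr
  · rw [hK]
    have h1 := real_inner_le_norm v (T v)
    nlinarith [hTn v, norm_nonneg v]

variable {A : Stack m d →L[ℝ] Stack m d} {K B W : Mat m d} {μ κ Λ : ℝ}

/-- `r = ⟨Bv, K B v⟩ / ⟨v, B v⟩`. Both this ratio and `qRatio` equal one when `B v = A v`. -/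
noncomputable def rRatio (K B : Mat m d) (v : Stack m d) : ℝ :=
  inner ℝ (act B v) (act K (act B v)) / inner ℝ v (act B v)

/-- `q = ⟨v, B v⟩ / ⟨v, A v⟩`. -/
noncomputable def qRatio (A : Stack m d →L[ℝ] Stack m d) (B : Mat m d) (v : Stack m d) : ℝ :=
  inner ℝ v (act B v) / inner ℝ v (A v)

/-- The decrease `r - 1 - log q` of the potential caused by the deviation of `B v` from `A v`. -/
noncomputable def defect (A : Stack m d →L[ℝ] Stack m d) (K B : Mat m d) (v : Stack m d) : ℝ :=
  rRatio K B v - 1 - Real.log (qRatio A B v)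

theorem rRatio_smul {c : ℝ} (hc : c ≠ 0) (v : Stack m d) : rRatio K B (c • v) = rRatio K B v := by
  simp only [rRatio, act_smul, inner_smul_left, inner_smul_right, conj_trivial, ← mul_assoc]
  exact mul_div_mul_left _ _ (mul_ne_zero hc hc)

theorem qRatio_smul {c : ℝ} (hc : c ≠ 0) (v : Stack m d) : qRatio A B (c • v) = qRatio A B v := by
  simp only [qRatio, act_smul, map_smul, inner_smul_left, inner_smul_right, conj_trivial,
    ← mul_assoc]
  exact mul_div_mul_left _ _ (mul_ne_zero hc hc)

theorem defect_smul {c : ℝ} (hc : c ≠ 0) (v : Stack m d) :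
    defect A K B (c • v) = defect A K B v := by
  rw [defect, rRatio_smul hc, qRatio_smul hc, defect]

namespace InversePair

theorem inner_pos (h : InversePair A K μ κ Λ) {v : Stack m d} (hv : v ≠ 0) :
    0 < (inner ℝ v (A v) : ℝ) :=
  lt_of_lt_of_le (mul_pos h.mu_pos (pow_pos (norm_pos_iff.2 hv) 2)) (h.coercive v)

theorem qRatio_pos (h : InversePair A K μ κ Λ) (hB : B.PosDef) {v : Stack m d} (hv : v ≠ 0) :
    0 < qRatio A B v :=
  div_pos ((posDef_iff_act.1 hB).2 v hv) (h.inner_pos hv)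

/-- The `K`-norm of `w - c • A v`, expanded. -/
theorem inner_sub_smul (h : InversePair A K μ κ Λ) (w v : Stack m d) (c : ℝ) :
    inner ℝ (w - c • A v) (act K (w - c • A v))
      = inner ℝ w (act K w) - 2 * c * inner ℝ v w + c ^ 2 * inner ℝ v (A v) := by
  have e1 : inner ℝ (A v) (act K w) = inner ℝ v w := by rw [← h.symm_inv, h.inv]
  simp only [act_sub, act_smul, h.inv, inner_sub_left, inner_sub_right, inner_smul_left,
    inner_smul_right, conj_trivial, e1, real_inner_comm w v, h.symm v v]
  ring

/-- Cauchy–Schwarz for the forms of `A` and `K = A⁻¹`. -/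
theorem qRatio_le_rRatio (h : InversePair A K μ κ Λ) (hB : B.PosDef) {v : Stack m d}
    (hv : v ≠ 0) : qRatio A B v ≤ rRatio K B v := by
  have hb := (posDef_iff_act.1 hB).2 v hv
  have ha := h.inner_pos hv
  have h1 := h.inner_sub_smul (act B v) v (qRatio A B v)
  have h2 : 0 ≤ inner ℝ (act B v - qRatio A B v • A v) (act K (act B v - qRatio A B v • A v)) :=
    le_trans (by have := h.kappa_pos; positivity) (h.coercive_inv _)
  rw [h1] at h2
  rw [rRatio, le_div_iff₀ hb]
  have h3 : qRatio A B v * inner ℝ v (A v) = inner ℝ v (act B v) := div_mul_cancel₀ _ ha.ne'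
  nlinarith

theorem defect_nonneg (h : InversePair A K μ κ Λ) (hB : B.PosDef) {v : Stack m d}
    (hv : v ≠ 0) : 0 ≤ defect A K B v := by
  have h1 := h.qRatio_le_rRatio hB hv
  have h2 := Real.log_le_sub_one_of_pos (h.qRatio_pos hB hv)
  rw [defect]
  linarith

/-- The Dennis–Moré quantity in terms of the two ratios. -/
theorem norm_sub_sq_le (h : InversePair A K μ κ Λ) (hB : B.PosDef) {v : Stack m d}
    (hv : v ≠ 0) : κ * ‖act B v - A v‖ ^ 2
      ≤ (qRatio A B v * rRatio K B v - 2 * qRatio A B v + 1) * (Λ * ‖v‖ ^ 2) := by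
  have hb := (posDef_iff_act.1 hB).2 v hv
  have ha := h.inner_pos hv
  have h1 := h.inner_sub_smul (act B v) v 1
  rw [one_smul] at h1
  have h2 := h.coercive_inv (act B v - A v)
  have h3 : qRatio A B v * inner ℝ v (A v) = inner ℝ v (act B v) := div_mul_cancel₀ _ ha.ne'
  have h4 : rRatio K B v * inner ℝ v (act B v) = inner ℝ (act B v) (act K (act B v)) :=
    div_mul_cancel₀ _ hb.ne'
  have h5 : inner ℝ (act B v - A v) (act K (act B v - A v))
      = (qRatio A B v * rRatio K B v - 2 * qRatio A B v + 1) * inner ℝ v (A v) := by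
    rw [h1, ← h4, ← h3]; ring
  have h6 : 0 ≤ qRatio A B v * rRatio K B v - 2 * qRatio A B v + 1 := by
    have := h.qRatio_pos hB hv
    have := h.qRatio_le_rRatio hB hv
    nlinarith [sq_nonneg (qRatio A B v - 1)]
  have h7 : inner ℝ v (A v) ≤ Λ * ‖v‖ ^ 2 := by
    have := real_inner_le_norm v (A v)
    nlinarith [h.bound v, norm_nonneg v]
  rw [h5] at h2
  exact h2.trans (mul_le_mul_of_nonneg_left h7 h6)

/-- One BFGS update changes the potential by at most the squared relative deviation of the secant
pair from `A`, minus the defect. -/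
theorem potential_step (h : InversePair A K μ κ Λ) (hW : W.PosDef) {s z : Stack m d}
    (hs : s ≠ 0) (hsz : μ * ‖s‖ ^ 2 ≤ inner ℝ s z) :
    potential K (bfgsUpdate W s z)⁻¹ ≤ potential K W⁻¹
      + (‖z - A s‖ / (μ * ‖s‖)) ^ 2 - defect A K W⁻¹ s := by
  have hμ := h.mu_pos
  have hsn := norm_pos_iff.2 hs
  have ht : 0 < (inner ℝ s z : ℝ) := lt_of_lt_of_le (by positivity) hsz
  have ha := h.inner_pos hs
  have hb := (posDef_iff_act.1 hW.inv).2 s hs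
  rw [potential_bfgsUpdate K hW ht]
  have h1 := h.inner_sub_smul z s 1
  rw [one_smul] at h1
  have h2 := h.upper_inv (z - A s)
  rw [h1] at h2
  have h3 := Real.log_le_sub_one_of_pos (div_pos ha ht)
  rw [Real.log_div ha.ne' ht.ne'] at h3
  have h4 : defect A K W⁻¹ s = inner ℝ (act W⁻¹ s) (act K (act W⁻¹ s)) / inner ℝ s (act W⁻¹ s) - 1
      - (Real.log (inner ℝ s (act W⁻¹ s)) - Real.log (inner ℝ s (A s))) := by
    rw [defect, qRatio, Real.log_div hb.ne' ha.ne', rRatio]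
  have h5 : inner ℝ z (act K z) / inner ℝ s z + inner ℝ s (A s) / inner ℝ s z - 2
      ≤ (‖z - A s‖ / (μ * ‖s‖)) ^ 2 := by
    have e1 : inner ℝ z (act K z) / inner ℝ s z + inner ℝ s (A s) / inner ℝ s z - 2
        = (inner ℝ z (act K z) - 2 * 1 * inner ℝ s z + 1 ^ 2 * inner ℝ s (A s)) / inner ℝ s z := by
      field_simp
      ring
    have e2 : (‖z - A s‖ / (μ * ‖s‖)) ^ 2 = (1 / μ * ‖z - A s‖ ^ 2) / (μ * ‖s‖ ^ 2) := by
      field_simp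
    rw [e1, e2]
    gcongr
  rw [h4]
  linarith

end InversePair

/-- A vanishing defect forces both ratios to one, because `r - 1 - log r ≥ (√r - 1)²`. -/
theorem tendsto_ratios {r q : ℕ → ℝ} (hq : ∀ n, 0 < q n) (hqr : ∀ n, q n ≤ r n)
    (hlim : Filter.Tendsto (fun n => r n - 1 - Real.log (q n)) Filter.atTop (nhds 0)) :
    Filter.Tendsto r Filter.atTop (nhds 1) ∧ Filter.Tendsto q Filter.atTop (nhds 1) := by
  have h1 : ∀ n, (√(r n) - 1) ^ 2 ≤ r n - 1 - Real.log (q n) := fun n => by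
    have hr := (hq n).trans_le (hqr n)
    have h2 := Real.log_le_log (hq n) (hqr n)
    have h3 := Real.log_le_sub_one_of_pos (Real.sqrt_pos.2 hr)
    rw [Real.log_sqrt hr.le] at h3
    have h4 := Real.sq_sqrt hr.le
    nlinarith
  have h2 : Filter.Tendsto (fun n => (√(r n) - 1) ^ 2) Filter.atTop (nhds 0) :=
    squeeze_zero (fun n => sq_nonneg _) h1 hlim
  have h3 : Filter.Tendsto (fun n => √(r n) - 1) Filter.atTop (nhds 0) :=
    tendsto_zero_iff_norm_tendsto_zero.2 (by simpa [Real.sqrt_sq_eq_abs] using h2.sqrt)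
  have hr : Filter.Tendsto r Filter.atTop (nhds 1) := by
    have h4 := (h3.add_const 1).pow 2
    simp only [sub_add_cancel, zero_add, one_pow] at h4
    exact h4.congr fun n => Real.sq_sqrt ((hq n).trans_le (hqr n)).le
  refine ⟨hr, ?_⟩
  have h5 := ((hr.sub_const 1).sub hlim).rexp
  simp only [sub_self, sub_sub_cancel, Real.exp_zero] at h5
  exact h5.congr fun n => Real.exp_log (hq n)

/-- The interplay of function values and potential. While the gap shrinks by the factor
`1 - c e^{-τ}`, the potential `ψ` pays for each large `τ`; so `log gap + κ ψ`, for a suitable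
weight `κ`, decreases by a fixed amount in each step and the gap is bounded by a geometric
sequence. Then the errors `ν` are summable, hence so are the defects `τ`. -/
theorem tendsto_of_potential {gap ψ τ ν : ℕ → ℝ} {c c₀ C D : ℝ} (hc : 0 < c) (hC : 0 ≤ C)
    (hgap : ∀ n, 0 < gap n) (hψ : ∀ n, c₀ ≤ ψ n) (hτ : ∀ n, 0 ≤ τ n)
    (hstep : ∀ n, ψ (n + 1) ≤ ψ n + ν n - τ n)
    (hdec : ∀ n, gap (n + 1) ≤ (1 - c * Real.exp (-τ n)) * gap n)
    (hνD : ∀ n, ν n ≤ D) (hν : ∀ n, ν n ≤ C * (gap n + gap (n + 1))) :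
    Filter.Tendsto gap Filter.atTop (nhds 0) ∧ Filter.Tendsto τ Filter.atTop (nhds 0) ∧
      ∃ M, ∀ n, ψ n ≤ M := by
  set κ : ℝ := c * Real.exp (-D) with hκ
  have hκ0 : 0 < κ := by positivity
  have hlog : ∀ n, Real.log (gap (n + 1)) + κ * ψ (n + 1) ≤ Real.log (gap n) + κ * ψ n - κ := by
    intro n
    have hpos : 0 < 1 - c * Real.exp (-τ n) :=
      pos_of_mul_pos_left ((hgap (n + 1)).trans_le (hdec n)) (hgap n).le
    have h1 := Real.log_le_log (hgap (n + 1)) (hdec n)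
    rw [Real.log_mul hpos.ne' (hgap n).ne'] at h1
    have h2 := Real.log_le_sub_one_of_pos hpos
    -- the tangent line of `τ ↦ exp (-τ)` at `D`
    have h3 : κ * (1 + D - τ n) ≤ c * Real.exp (-τ n) := by
      have h4 := Real.add_one_le_exp (D - τ n)
      have h5 : Real.exp (-τ n) = Real.exp (-D) * Real.exp (D - τ n) := by
        rw [← Real.exp_add]; congr 1; ring
      rw [h5, hκ, ← mul_assoc]
      gcongr
      linarith
    have h6 : κ * ψ (n + 1) ≤ κ * (ψ n + D - τ n) := by
      have := hstep n
      have := hνD n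
      gcongr
      linarith
    linarith
  have hlogn : ∀ n : ℕ, Real.log (gap n) + κ * ψ n ≤ Real.log (gap 0) + κ * ψ 0 - n * κ := by
    intro n
    induction n with
    | zero => simp
    | succ n ih =>
      have := hlog n
      push_cast
      linarith
  set a : ℝ := Real.exp (Real.log (gap 0) + κ * ψ 0 - κ * c₀) with ha
  have hgeo : ∀ n, gap n ≤ a * Real.exp (-κ) ^ n := fun n => by
    rw [← Real.exp_nat_mul, ha, ← Real.exp_add, ← Real.log_le_iff_le_exp (hgap n)]
    have h1 : κ * c₀ ≤ κ * ψ n := by have := hψ n; gcongr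
    linarith [hlogn n]
  have hρ : Real.exp (-κ) < 1 := Real.exp_lt_one_iff.2 (by linarith)
  have hsum : Summable fun n => a * Real.exp (-κ) ^ n :=
    (summable_geometric_of_lt_one (Real.exp_pos _).le hρ).mul_left a
  have hgs : Summable gap := Summable.of_nonneg_of_le (fun n => (hgap n).le) hgeo hsum
  have hgs' : Summable fun n => C * (gap n + gap (n + 1)) :=
    (hgs.add ((summable_nat_add_iff 1).2 hgs)).mul_left C
  set S := ∑' n, C * (gap n + gap (n + 1)) with hS
  have hpart : ∀ n, ψ n + ∑ i ∈ Finset.range n, τ i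
      ≤ ψ 0 + ∑ i ∈ Finset.range n, C * (gap i + gap (i + 1)) := by
    intro n
    induction n with
    | zero => simp
    | succ n ih =>
      rw [Finset.sum_range_succ, Finset.sum_range_succ]
      linarith [hstep n, hν n]
  have hS' : ∀ n, ∑ i ∈ Finset.range n, C * (gap i + gap (i + 1)) ≤ S := fun n =>
    hgs'.sum_le_tsum _ fun i _ =>
      mul_nonneg hC (add_nonneg (hgap i).le (hgap (i + 1)).le)
  have hτs : Summable τ := summable_of_sum_range_le (c := ψ 0 + S - c₀) hτ fun n => by
    linarith [hpart n, hS' n, hψ n]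
  exact ⟨hgs.tendsto_atTop_zero, hτs.tendsto_atTop_zero, ψ 0 + S, fun n => by
    linarith [hpart n, hS' n, Finset.sum_nonneg fun i (_ : i ∈ Finset.range n) => hτ i]⟩

end Ratios

/-! ### Descent along a run -/

section Run

variable {m d : ℕ} {H : Stack m d → ℝ} {g : Stack m d → Stack m d} {μ ℓ γ σ δ κ Λ : ℝ}
  {A : Stack m d →L[ℝ] Stack m d} {K : Mat m d} {yStar : Stack m d}

/-- Both kinds of step reduce the gap by a factor that depends only on the defect. -/
theorem exists_gap_step (h : RegularConvex H g μ ℓ) (hI : InversePair A K μ κ Λ) (hγ : 0 < γ)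
    (hup : ∀ u v, inner ℝ (g u - g v) (u - v) ≤ 1 / γ * ‖u - v‖ ^ 2)
    (hσ : 0 < σ) (hδ : δ ∈ Set.Ioo 0 γ) (hstar : g yStar = 0) :
    ∃ c, 0 < c ∧ ∀ (y : Stack m d) (W : Mat m d) (η : ℝ), W.PosDef → g y ≠ 0 →
      (η = δ * inner ℝ (act W (g y)) (g y) / ‖act W (g y)‖ ^ 2 ∨
        η = 1 ∧ H (y - act W (g y)) ≤ H y - σ * inner ℝ (act W (g y)) (g y)) →
      H (y - η • act W (g y)) - H yStar
        ≤ (1 - c * Real.exp (-defect A K W⁻¹ (act W (g y)))) * (H y - H yStar) := by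
  have hμ := hI.mu_pos
  have hκ := hI.kappa_pos
  have hδγ : 0 < 1 - δ / γ := sub_pos.2 ((div_lt_one hγ).2 hδ.2)
  have hδ0 := hδ.1
  set c₁ : ℝ := min (δ * (1 - δ / γ) * μ) (σ * Real.exp (-1)) with hc₁
  have hc₁0 : 0 < c₁ := by rw [hc₁, lt_min_iff]; constructor <;> positivity
  refine ⟨c₁ * κ * μ, by positivity, fun y W η hW hgy hη => ?_⟩
  set p := act W (g y) with hp
  have hBp : act W⁻¹ p = g y := act_inv_act hW _
  have hp0 : p ≠ 0 := fun h0 => hgy (by rw [← hBp, h0, act_zero])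
  set b : ℝ := inner ℝ p (g y) with hb
  have hb0 : 0 < b := by
    have := (posDef_iff_act.1 hW.inv).2 p hp0
    rwa [hBp] at this
  have ha := hI.inner_pos hp0
  have hpn := norm_pos_iff.2 hp0
  set τ := defect A K W⁻¹ p with hτ
  set r := rRatio K W⁻¹ p with hr
  set q := qRatio A W⁻¹ p with hq
  have hq0 : 0 < q := hI.qRatio_pos hW.inv hp0
  have hqr : q ≤ r := hI.qRatio_le_rRatio hW.inv hp0
  have hr0 : 0 < r := hq0.trans_le hqr
  have hqb : q * inner ℝ p (A p) = b := by
    rw [hq, qRatio, hBp]; exact div_mul_cancel₀ _ ha.ne'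
  have hrb : r * b = inner ℝ (g y) (act K (g y)) := by
    rw [hr, rRatio, hBp]; exact div_mul_cancel₀ _ hb0.ne'
  have hw := hI.coercive_inv (g y)
  rw [← hrb] at hw
  have hτe : τ = r - 1 - Real.log q := rfl
  -- the decrease is at least `c₁ κ e^{-τ} ‖g y‖²`
  have hdec : H (y - η • p) ≤ H y - c₁ * Real.exp (-τ) * (κ * ‖g y‖ ^ 2) := by
    rcases hη with hη | ⟨hη, hB⟩
    · have h1 : H (y - η • p) ≤ H y - δ * (1 - δ / γ) * (b ^ 2 / ‖p‖ ^ 2) := by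
        have h2 := h.subgrad y (y - η • p)
        have h3 := hup y (y - η • p)
        rw [sub_sub_cancel, inner_sub_left] at h3
        rw [sub_sub_cancel] at h2
        rw [inner_smul_right (g y), real_inner_comm p (g y), ← hb, norm_smul, mul_pow,
          Real.norm_eq_abs, sq_abs] at h3
        have e : η * b - 1 / γ * (η ^ 2 * ‖p‖ ^ 2) = δ * (1 - δ / γ) * (b ^ 2 / ‖p‖ ^ 2) := by
          rw [hη]; field_simp
        linarith
      refine h1.trans (sub_le_sub_left ?_ _)
      have h4 : Real.exp (-τ) ≤ q / r := by
        rw [← Real.le_log_iff_exp_le (div_pos hq0 hr0), Real.log_div hq0.ne' hr0.ne', hτe]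
        linarith [Real.log_le_sub_one_of_pos hr0]
      have h5 : μ * (q * b) ≤ b ^ 2 / ‖p‖ ^ 2 := by
        rw [le_div_iff₀ (by positivity)]
        have := hI.coercive p
        have h6 : q * (μ * ‖p‖ ^ 2) ≤ b := by rw [← hqb]; gcongr
        nlinarith
      calc c₁ * Real.exp (-τ) * (κ * ‖g y‖ ^ 2) ≤ δ * (1 - δ / γ) * μ * (q / r) * (r * b) := by
            gcongr
            exact min_le_left _ _
        _ = δ * (1 - δ / γ) * (μ * (q * b)) := by field_simp
        _ ≤ _ := by gcongr
    · rw [hη, one_smul]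
      refine hB.trans (sub_le_sub_left ?_ _)
      have h4 : Real.exp (-τ) ≤ Real.exp 1 / r := by
        rw [← Real.le_log_iff_exp_le (by positivity), Real.log_div (Real.exp_pos 1).ne' hr0.ne',
          Real.log_exp, hτe]
        have h5 := Real.log_le_sub_one_of_pos (half_pos hr0)
        rw [Real.log_div hr0.ne' two_ne_zero] at h5
        have h6 := Real.log_le_sub_one_of_pos (zero_lt_two (α := ℝ))
        linarith [Real.log_le_log hq0 hqr]
      calc c₁ * Real.exp (-τ) * (κ * ‖g y‖ ^ 2)
          ≤ σ * Real.exp (-1) * (Real.exp 1 / r) * (r * b) := by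
            gcongr
            exact min_le_right _ _
        _ = σ * b * (Real.exp (-1) * Real.exp 1) := by field_simp
        _ = σ * b := by rw [← Real.exp_add]; simp
  have hgap : μ * (H y - H yStar) ≤ ‖g y‖ ^ 2 := by
    have h1 := h.subgrad yStar y
    have h2 := real_inner_le_norm (g y) (y - yStar)
    have h3 := h.mul_norm_le y yStar
    rw [hstar, sub_zero] at h3
    rw [← neg_sub y yStar, inner_neg_right] at h1
    nlinarith [norm_nonneg (g y)]
  have h7 : c₁ * Real.exp (-τ) * κ * (μ * (H y - H yStar)) ≤ c₁ * Real.exp (-τ) * κ * ‖g y‖ ^ 2 := by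
    gcongr
  linarith

variable {B₀ : Mat m d} {y : ℕ → Stack m d} {W : ℕ → Mat m d} {η : ℕ → ℝ}

theorem IsRun.step_cases (hrun : IsRun H γ σ δ B₀ y W η) {k : ℕ} (hk : 1 ≤ k) :
    η k = δ * inner ℝ (dir H y W k) (gradient H (y k)) / ‖dir H y W k‖ ^ 2 ∨
      η k = 1 ∧ CondB H σ y W k := by
  by_cases hc : ¬ CondA H γ σ y W k ∧ CondB H σ y W k
  · exact Or.inr ⟨hrun.unit_step k hk hc, hc.2⟩
  · exact Or.inl (hrun.short_step k hk (by tauto))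

theorem IsRun.sVec_eq (hrun : IsRun H γ σ δ B₀ y W η) {k : ℕ} (hk : 1 ≤ k) :
    sVec y k = (-η k) • dir H y W k := by
  rw [sVec, hrun.update_point k hk]
  module

theorem IsRun.update_succ (hrun : IsRun H γ σ δ B₀ y W η) (k : ℕ) :
    W (k + 1) = bfgsUpdate (W k) (sVec y k) (zVec H y k) :=
  hrun.update_mat (k + 1) (Nat.le_add_left 1 k)

theorem mul_sVec_sq_le_inner_zVec (h : RegularConvex H (gradient H) μ ℓ) (k : ℕ) :
    μ * ‖sVec y k‖ ^ 2 ≤ inner ℝ (sVec y k) (zVec H y k) := by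
  rw [real_inner_comm]
  exact h.strong _ _

theorem act_inv_dir (hW : ∀ k, (W k).PosDef) (k : ℕ) :
    act (W k)⁻¹ (dir H y W k) = gradient H (y k) :=
  act_inv_act (hW k) _

/-- As long as no stationary point is met, the matrices stay positive definite and the points
keep moving. -/
theorem IsRun.posDef_and_ne (hrun : IsRun H γ σ δ B₀ y W η) (h : RegularConvex H (gradient H) μ ℓ)
    (hδ : 0 < δ) (hB₀ : B₀.PosDef) (hne : ∀ k, 1 ≤ k → gradient H (y k) ≠ 0) (k : ℕ) :
    (W k).PosDef ∧ sVec y k ≠ 0 := by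
  induction k with
  | zero =>
    refine ⟨by rw [hrun.init_mat]; exact hB₀.inv, ?_⟩
    exact sub_ne_zero.2 hrun.init_ne.symm
  | succ k ih =>
    have hk : 1 ≤ k + 1 := Nat.le_add_left 1 k
    have hs := norm_pos_iff.2 ih.2
    have hμ := h.mu_pos
    have hW : (W (k + 1)).PosDef := by
      rw [hrun.update_succ]
      exact bfgsUpdate_posDef ih.1
        (lt_of_lt_of_le (by positivity) (mul_sVec_sq_le_inner_zVec h k))
    refine ⟨hW, ?_⟩
    have hb : 0 < (inner ℝ (dir H y W (k + 1)) (gradient H (y (k + 1))) : ℝ) := by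
      rw [real_inner_comm]
      exact (posDef_iff_act.1 hW).2 _ (hne _ hk)
    have hp : dir H y W (k + 1) ≠ 0 := fun h0 => by
      rw [h0, inner_zero_left] at hb; exact lt_irrefl _ hb
    have hpn := norm_pos_iff.2 hp
    have hη : 0 < η (k + 1) := by
      rcases hrun.step_cases hk with h1 | h1
      · rw [h1]; positivity
      · rw [h1.1]; exact one_pos
    rw [hrun.sVec_eq hk]
    exact smul_ne_zero (neg_ne_zero.2 hη.ne') hp

/-- Convergence of a run without stationary points, together with the Dennis–Moré property: along
the directions used, `B_k` acts like the Hessian `A` at the minimizer, up to a relative error `ω k`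
tending to zero. -/
theorem IsRun.dennis_more (hrun : IsRun H γ σ δ B₀ y W η) (h : RegularConvex H (gradient H) μ ℓ)
    (hI : InversePair A K μ κ Λ) (hγ : 0 < γ)
    (hup : ∀ u v, inner ℝ (gradient H u - gradient H v) (u - v) ≤ 1 / γ * ‖u - v‖ ^ 2)
    {C : ℝ} (hC : 0 ≤ C) (hA : ∀ u v, ‖gradient H u - gradient H v - A (u - v)‖
      ≤ C * (‖u - yStar‖ + ‖v - yStar‖) * ‖u - v‖)
    (hσ : 0 < σ) (hδ : δ ∈ Set.Ioo 0 γ) (hB₀ : B₀.PosDef) (hstar : gradient H yStar = 0)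
    (hne : ∀ k, 1 ≤ k → gradient H (y k) ≠ 0) :
    Filter.Tendsto (fun n => ‖y (n + 1) - yStar‖) Filter.atTop (nhds 0) ∧
    ∃ (ω : ℕ → ℝ) (a b : ℝ), Filter.Tendsto ω Filter.atTop (nhds 0) ∧ 0 < a ∧ 0 < b ∧
      ∀ n, ‖act (W (n + 1))⁻¹ (dir H y W (n + 1)) - A (dir H y W (n + 1))‖
          ≤ ω n * ‖dir H y W (n + 1)‖ ∧
        ‖act (W (n + 1))⁻¹ (sVec y (n + 1)) - A (sVec y (n + 1))‖ ≤ ω n * ‖sVec y (n + 1)‖ ∧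
        ‖zVec H y (n + 1) - A (sVec y (n + 1))‖ ≤ ω n * ‖sVec y (n + 1)‖ ∧
        ∀ v, a * ‖v‖ ≤ ‖act (W (n + 1))⁻¹ v‖ ∧ ‖act (W (n + 1))⁻¹ v‖ ≤ b * ‖v‖ := by
  have hμ := hI.mu_pos
  have hκ := hI.kappa_pos
  have hΛ := hI.lam_pos
  have hWs := hrun.posDef_and_ne h hδ.1 hB₀ hne
  have hW := fun k => (hWs k).1
  have hs := fun k => (hWs k).2
  have hk : ∀ n : ℕ, 1 ≤ n + 1 := Nat.le_add_left 1
  have hηne : ∀ n, -η (n + 1) ≠ 0 := fun n h0 => hs (n + 1) (by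
    rw [hrun.sVec_eq (hk n), h0, zero_smul])
  have hp : ∀ n, dir H y W (n + 1) ≠ 0 := fun n h0 => hs (n + 1) (by
    rw [hrun.sVec_eq (hk n), h0, smul_zero])
  obtain ⟨c, hc, hdec⟩ := exists_gap_step h hI hγ hup hσ hδ hstar
  have hgrow : ∀ u, μ / 4 * ‖u - yStar‖ ^ 2 ≤ H u - H yStar := fun u => by
    have := h.quadratic_growth u yStar
    rw [hstar, inner_zero_left] at this
    linarith
  have hgap0 : ∀ n, 0 < H (y (n + 1)) - H yStar := fun n => by
    refine lt_of_lt_of_le ?_ (hgrow _)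
    have : y (n + 1) - yStar ≠ 0 := fun h0 => hne _ (hk n) (by rw [sub_eq_zero.1 h0, hstar])
    have := norm_pos_iff.2 this
    positivity
  obtain ⟨c₀, hc₀⟩ := exists_le_potential hκ hI.coercive_inv
  have hdev : ∀ n, ‖zVec H y (n + 1) - A (sVec y (n + 1))‖
      ≤ C * (‖y (n + 2) - yStar‖ + ‖y (n + 1) - yStar‖) * ‖sVec y (n + 1)‖ := fun n => hA _ _
  have hν1 : ∀ n, (‖zVec H y (n + 1) - A (sVec y (n + 1))‖ / (μ * ‖sVec y (n + 1)‖)) ^ 2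
      ≤ ((ℓ + Λ) / μ) ^ 2 := fun n => by
    have hsn := norm_pos_iff.2 (hs (n + 1))
    have h1 : ‖zVec H y (n + 1) - A (sVec y (n + 1))‖ ≤ (ℓ + Λ) * ‖sVec y (n + 1)‖ := by
      refine (norm_sub_le _ _).trans ?_
      rw [add_mul]
      exact add_le_add (h.lip _ _) (hI.bound _)
    gcongr ?_ ^ 2
    rw [div_le_div_iff₀ (by positivity) hμ]
    nlinarith
  have hν2 : ∀ n, (‖zVec H y (n + 1) - A (sVec y (n + 1))‖ / (μ * ‖sVec y (n + 1)‖)) ^ 2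
      ≤ (C / μ) ^ 2 * (2 * (4 / μ)) * ((H (y (n + 1)) - H yStar) + (H (y (n + 1 + 1)) - H yStar)) :=
    fun n => by
    have hsn := norm_pos_iff.2 (hs (n + 1))
    have h1 : ‖zVec H y (n + 1) - A (sVec y (n + 1))‖ / (μ * ‖sVec y (n + 1)‖)
        ≤ C / μ * (‖y (n + 2) - yStar‖ + ‖y (n + 1) - yStar‖) := by
      rw [div_le_iff₀ (by positivity)]
      refine (hdev n).trans_eq ?_
      field_simp
    have h2 : ∀ u, ‖u - yStar‖ ^ 2 ≤ 4 / μ * (H u - H yStar) := fun u => by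
      have := hgrow u
      rw [div_mul_eq_mul_div, le_div_iff₀ hμ]
      linarith
    have h3 := h2 (y (n + 1))
    have h4 := h2 (y (n + 2))
    calc _ ≤ (C / μ * (‖y (n + 2) - yStar‖ + ‖y (n + 1) - yStar‖)) ^ 2 := by gcongr
      _ = (C / μ) ^ 2 * (‖y (n + 2) - yStar‖ + ‖y (n + 1) - yStar‖) ^ 2 := mul_pow _ _ _
      _ ≤ (C / μ) ^ 2 * (2 * (4 / μ) * ((H (y (n + 1)) - H yStar)
          + (H (y (n + 2)) - H yStar))) := by
        gcongr
        nlinarith [sq_nonneg (‖y (n + 2) - yStar‖ - ‖y (n + 1) - yStar‖)]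
      _ = _ := by ring
  obtain ⟨hgapt, hτt, M, hM⟩ := tendsto_of_potential
    (gap := fun n => H (y (n + 1)) - H yStar)
    (ψ := fun n => potential K (W (n + 1))⁻¹)
    (τ := fun n => defect A K (W (n + 1))⁻¹ (dir H y W (n + 1)))
    (ν := fun n => (‖zVec H y (n + 1) - A (sVec y (n + 1))‖ / (μ * ‖sVec y (n + 1)‖)) ^ 2)
    (C := (C / μ) ^ 2 * (2 * (4 / μ)))
    hc (by positivity) hgap0 (fun n => hc₀ _ (hW _).inv)
    (fun n => hI.defect_nonneg (hW _).inv (hp n))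
    (fun n => by
      have := hI.potential_step (hW (n + 1)) (hs (n + 1)) (mul_sVec_sq_le_inner_zVec h (n + 1))
      rw [← hrun.update_succ, hrun.sVec_eq (hk n), defect_smul (hηne n),
        ← hrun.sVec_eq (hk n)] at this
      exact this)
    (fun n => by
      have := hdec (y (n + 1)) (W (n + 1)) (η (n + 1)) (hW _) (hne _ (hk n))
        (hrun.step_cases (hk n))
      rw [hrun.update_point (n + 1) (hk n)]
      exact this)
    hν1 hν2
  have hyt : Filter.Tendsto (fun n => ‖y (n + 1) - yStar‖) Filter.atTop (nhds 0) := by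
    have h1 : Filter.Tendsto (fun n => √(4 / μ * (H (y (n + 1)) - H yStar))) Filter.atTop
        (nhds 0) := by simpa using (hgapt.const_mul (4 / μ)).sqrt
    refine squeeze_zero (fun n => norm_nonneg _) (fun n => Real.le_sqrt_of_sq_le ?_) h1
    have := hgrow (y (n + 1))
    rw [div_mul_eq_mul_div, le_div_iff₀ hμ]
    linarith
  refine ⟨hyt, ?_⟩
  obtain ⟨a, b, ha, hb, hab⟩ := exists_bounds_of_potential_le hκ hI.coercive_inv M
  obtain ⟨hrt, hqt⟩ := tendsto_ratios
    (r := fun n => rRatio K (W (n + 1))⁻¹ (dir H y W (n + 1)))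
    (q := fun n => qRatio A (W (n + 1))⁻¹ (dir H y W (n + 1)))
    (fun n => hI.qRatio_pos (hW _).inv (hp n)) (fun n => hI.qRatio_le_rRatio (hW _).inv (hp n)) hτt
  set r : ℕ → ℝ := fun n => rRatio K (W (n + 1))⁻¹ (dir H y W (n + 1)) with hr
  set q : ℕ → ℝ := fun n => qRatio A (W (n + 1))⁻¹ (dir H y W (n + 1)) with hq
  set ω₁ : ℕ → ℝ := fun n => √(Λ / κ * (q n * r n - 2 * q n + 1)) with hω₁
  set ω₂ : ℕ → ℝ := fun n => C * (‖y (n + 2) - yStar‖ + ‖y (n + 1) - yStar‖) with hω₂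
  have hω₁t : Filter.Tendsto ω₁ Filter.atTop (nhds 0) := by
    have h1 := ((((hqt.mul hrt).sub (hqt.const_mul 2)).add_const 1).const_mul (Λ / κ)).sqrt
    norm_num at h1
    exact h1
  have hω₂t : Filter.Tendsto ω₂ Filter.atTop (nhds 0) := by
    simpa using (((Filter.tendsto_add_atTop_iff_nat 1).2 hyt).add hyt).const_mul C
  have hω₁0 : ∀ n, 0 ≤ ω₁ n := fun n => Real.sqrt_nonneg _
  have hω₂0 : ∀ n, 0 ≤ ω₂ n := fun n => by positivity
  have hdm : ∀ n v, v ≠ 0 → rRatio K (W (n + 1))⁻¹ v = r n → qRatio A (W (n + 1))⁻¹ v = q n →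
      ‖act (W (n + 1))⁻¹ v - A v‖ ≤ (ω₁ n + ω₂ n) * ‖v‖ := fun n v hv hr' hq' => by
    have h1 := hI.norm_sub_sq_le (hW (n + 1)).inv hv
    rw [hr', hq'] at h1
    have h2 : ‖act (W (n + 1))⁻¹ v - A v‖ ≤ √(Λ / κ * (q n * r n - 2 * q n + 1) * ‖v‖ ^ 2) := by
      refine Real.le_sqrt_of_sq_le ?_
      rw [div_mul_eq_mul_div, div_mul_eq_mul_div, le_div_iff₀ hκ]
      linarith
    rw [Real.sqrt_mul' _ (sq_nonneg _), Real.sqrt_sq (norm_nonneg _)] at h2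
    have := hω₂0 n
    refine h2.trans ?_
    gcongr
    exact le_add_of_nonneg_right this
  refine ⟨fun n => ω₁ n + ω₂ n, a, b, by simpa using hω₁t.add hω₂t, ha, hb, fun n =>
    ⟨hdm n _ (hp n) rfl rfl, hdm n _ (hs (n + 1)) ?_ ?_, (hdev n).trans ?_,
      hab _ (hW _).inv (hM n)⟩⟩
  · rw [hrun.sVec_eq (hk n), rRatio_smul (hηne n)]
  · rw [hrun.sVec_eq (hk n), qRatio_smul (hηne n)]
  · have := hω₁0 n
    gcongr
    exact le_add_of_nonneg_left this

end Run

/-! ### Acceptance of the unit step and superlinear convergence -/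

section Late

variable {m d : ℕ} {H : Stack m d → ℝ} {μ ℓ γ σ δ : ℝ} {yStar : Stack m d}
  {B₀ : Mat m d} {y : ℕ → Stack m d} {W : ℕ → Mat m d} {η : ℕ → ℝ}

/-- The three claims for a run that meets no stationary point. -/
theorem IsRun.superlinear_of_ne (hrun : IsRun H γ σ δ B₀ y W η)
    (h : RegularConvex H (gradient H) μ ℓ) (hγ : 0 < γ)
    (hup : ∀ u v, inner ℝ (gradient H u - gradient H v) (u - v) ≤ 1 / γ * ‖u - v‖ ^ 2)
    (hσ : σ ∈ Set.Ioo (0 : ℝ) (1 / 2)) (hδ : δ ∈ Set.Ioo 0 γ) (hB₀ : B₀.PosDef)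
    (hstar : gradient H yStar = 0) (hne : ∀ k, 1 ≤ k → gradient H (y k) ≠ 0) :
    Filter.Tendsto y Filter.atTop (nhds yStar) ∧
      (fun k => y (k + 1) - yStar) =o[Filter.atTop] (fun k => y k - yStar) ∧
      ∀ᶠ k in Filter.atTop, (¬ CondA H γ σ y W k ∧ CondB H σ y W k) ∧ η k = 1 := by
  obtain ⟨A, hAs, C, hC, hA⟩ := h.hess yStar
  have hμ := h.mu_pos
  obtain ⟨K, κ, Λ, hI⟩ := exists_inversePair hμ hAs (h.model_coercive hA)
  have hWs := hrun.posDef_and_ne h hδ.1 hB₀ hne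
  have hW := fun k => (hWs k).1
  obtain ⟨hyt, ω, a, b, hωt, ha, hb, hω⟩ :=
    hrun.dennis_more h hI hγ hup hC hA hσ.1 hδ hB₀ hstar hne
  have hyt' : Filter.Tendsto y Filter.atTop (nhds yStar) :=
    (Filter.tendsto_add_atTop_iff_nat 1).1 (tendsto_iff_norm_sub_tendsto_zero.2 hyt)
  have hωt' := (Filter.tendsto_add_atTop_iff_nat 1).2 hωt
  have hgt : Filter.Tendsto (fun n => ‖gradient H (y (n + 1))‖) Filter.atTop (nhds 0) := by
    have h1 := ((h.continuous_grad.tendsto yStar).comp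
      ((Filter.tendsto_add_atTop_iff_nat 1).2 hyt')).norm
    rwa [hstar, norm_zero] at h1
  have hst : Filter.Tendsto (fun n => ‖sVec y (n + 1)‖) Filter.atTop (nhds 0) := by
    have h1 := (((Filter.tendsto_add_atTop_iff_nat 2).2 hyt').sub
      ((Filter.tendsto_add_atTop_iff_nat 1).2 hyt')).norm
    rwa [sub_self, norm_zero] at h1
  have hσ2 : 0 < 1 - 2 * σ := by linarith [hσ.2]
  -- the norm of the direction and the curvature along it
  have hpn : ∀ n, 0 < ‖dir H y W (n + 1)‖ := fun n => norm_pos_iff.2 fun h0 =>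
    hne (n + 1) (Nat.le_add_left 1 n) (by rw [← act_inv_dir hW, h0, act_zero])
  have hdev : ∀ n, |inner ℝ (dir H y W (n + 1)) (gradient H (y (n + 1)))
      - inner ℝ (dir H y W (n + 1)) (A (dir H y W (n + 1)))| ≤ ω n * ‖dir H y W (n + 1)‖ ^ 2 :=
    fun n => by
    have h1 := abs_real_inner_le_norm (dir H y W (n + 1))
      (act (W (n + 1))⁻¹ (dir H y W (n + 1)) - A (dir H y W (n + 1)))
    rw [act_inv_dir hW, inner_sub_right] at h1
    have h2 := (hω n).1
    rw [act_inv_dir hW] at h2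
    nlinarith [hpn n]
  have hcurv : ∀ n, (μ - ω n) * ‖dir H y W (n + 1)‖ ^ 2
      ≤ inner ℝ (dir H y W (n + 1)) (gradient H (y (n + 1))) := fun n => by
    have h1 := hI.coercive (dir H y W (n + 1))
    have h2 := (abs_le.1 (hdev n)).1
    linarith
  have hq : ∀ n, qVal H γ y W (n + 1)
      ≤ 2 * b / a * ω n + 1 / γ * ‖sVec y (n + 1)‖ + ‖gradient H (y (n + 1))‖ := fun n => by
    rw [qVal]
    gcongr
    obtain ⟨-, h1, h2, h3⟩ := hω n
    have hsn := norm_pos_iff.2 (hWs (n + 1)).2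
    set s := sVec y (n + 1)
    set z := zVec H y (n + 1)
    have h4 : a * ‖s - act (W (n + 1)) z‖ ≤ 2 * ω n * ‖s‖ := by
      refine (h3 _).1.trans ?_
      rw [act_sub, act_inv_act (hW _)]
      calc ‖act (W (n + 1))⁻¹ s - z‖ = ‖(act (W (n + 1))⁻¹ s - A s) - (z - A s)‖ := by
            congr 1; abel
        _ ≤ _ := (norm_sub_le _ _).trans (by linarith)
    have h5 := (h3 (act (W (n + 1)) s)).2
    rw [act_inv_act (hW _)] at h5
    have h6 : 0 < ‖act (W (n + 1)) s‖ := pos_of_mul_pos_right (hsn.trans_le h5) hb.le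
    have hω0 : 0 ≤ ω n := nonneg_of_mul_nonneg_left ((norm_nonneg _).trans h1) hsn
    rw [div_le_iff₀ h6, div_mul_eq_mul_div, div_mul_eq_mul_div, le_div_iff₀ ha]
    nlinarith
  have hA' : ∀ᶠ n in Filter.atTop, ¬ CondA H γ σ y W (n + 2) := by
    have h1 : Filter.Tendsto (fun n => 2 * b / a * ω n + 1 / γ * ‖sVec y (n + 1)‖
        + ‖gradient H (y (n + 1))‖) Filter.atTop (nhds 0) := by
      simpa using ((hωt.const_mul (2 * b / a)).add (hst.const_mul (1 / γ))).add hgt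
    have h2 : Filter.Tendsto (fun n => (1 - 2 * σ) * (μ - ω (n + 1)) / 4) Filter.atTop
        (nhds ((1 - 2 * σ) * (μ - 0) / 4)) :=
      ((hωt'.const_sub μ).const_mul (1 - 2 * σ)).div_const 4
    filter_upwards [h1.eventually_lt h2 (by rw [sub_zero]; positivity)] with n hn hcond
    rw [CondA, show n + 2 - 1 = n + 1 from rfl] at hcond
    refine absurd (hcond.trans (hq n)) (not_le.2 (hn.trans_le ?_))
    have h3 := hcurv (n + 1)
    have h4 := hpn (n + 1)
    rw [div_le_div_iff₀ (by norm_num) (by positivity)]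
    nlinarith
  have hB' : ∀ᶠ n in Filter.atTop, CondB H σ y W (n + 1) := by
    have h1 : Filter.Tendsto (fun n => ω n / 2
        + C * (2 * ‖y (n + 1) - yStar‖ + 1 / a * ‖gradient H (y (n + 1))‖)) Filter.atTop
        (nhds 0) := by
      simpa using (hωt.div_const 2).add (((hyt.const_mul 2).add (hgt.const_mul (1 / a))).const_mul C)
    have h2 : Filter.Tendsto (fun n => (1 / 2 - σ) * (μ - ω n)) Filter.atTop
        (nhds ((1 / 2 - σ) * (μ - 0))) := (hωt.const_sub μ).const_mul (1 / 2 - σ)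
    have hσ3 : 0 < 1 / 2 - σ := by linarith
    filter_upwards [h1.eventually_lt h2 (by rw [sub_zero]; positivity)] with n hn
    rw [CondB]
    have h3 := h.taylor_upper hC hA (y (n + 1)) (-dir H y W (n + 1))
    rw [← sub_eq_add_neg, map_neg, inner_neg_neg, norm_neg, inner_neg_right,
      real_inner_comm (dir H y W (n + 1)), real_inner_comm (dir H y W (n + 1))] at h3
    have h4 := (abs_le.1 (hdev n)).1
    have h5 := hcurv n
    have h6 : ‖dir H y W (n + 1)‖ ≤ 1 / a * ‖gradient H (y (n + 1))‖ := by
      have := ((hω n).2.2.2 (dir H y W (n + 1))).1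
      rw [act_inv_dir hW] at this
      rw [one_div, ← div_eq_inv_mul, le_div_iff₀ ha]
      linarith
    have h7 : C * (2 * ‖y (n + 1) - yStar‖ + ‖dir H y W (n + 1)‖) * ‖dir H y W (n + 1)‖ ^ 2
        ≤ C * (2 * ‖y (n + 1) - yStar‖ + 1 / a * ‖gradient H (y (n + 1))‖)
          * ‖dir H y W (n + 1)‖ ^ 2 := by gcongr
    have h8 := mul_le_mul_of_nonneg_right hn.le (sq_nonneg ‖dir H y W (n + 1)‖)
    nlinarith
  have hacc : ∀ᶠ k in Filter.atTop, (¬ CondA H γ σ y W k ∧ CondB H σ y W k) ∧ η k = 1 := by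
    rw [← Filter.map_add_atTop_eq_nat 2, Filter.eventually_map]
    filter_upwards [hA', (Filter.tendsto_add_atTop_nat 1).eventually hB'] with n h1 h2
    exact ⟨⟨h1, h2⟩, hrun.unit_step _ (by omega) ⟨h1, h2⟩⟩
  refine ⟨hyt', ?_, hacc⟩
  rw [Asymptotics.isLittleO_iff]
  intro c hc
  rw [← Filter.map_add_atTop_eq_nat 1, Filter.eventually_map]
  have hsmall : ∀ᶠ n in Filter.atTop, 2 * ω n < c * μ / (1 + c) := by
    have := hωt.const_mul 2
    rw [mul_zero] at this
    exact this.eventually (gt_mem_nhds (by positivity))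
  filter_upwards [hsmall, (Filter.tendsto_add_atTop_nat 1).eventually hacc] with n h1 h2
  rw [lt_div_iff₀ (by positivity)] at h1
  obtain ⟨-, h3, h4, -⟩ := hω n
  have hs : sVec y (n + 1) = -dir H y W (n + 1) := by
    rw [hrun.sVec_eq (Nat.le_add_left 1 n), h2.2]; module
  -- with a unit step `B s = -∇H(y)`, so that the new gradient is `z - B s`
  have h5 : gradient H (y (n + 2)) = (zVec H y (n + 1) - A (sVec y (n + 1)))
      - (act (W (n + 1))⁻¹ (sVec y (n + 1)) - A (sVec y (n + 1))) := by
    have h6 : act (W (n + 1))⁻¹ (sVec y (n + 1)) = -gradient H (y (n + 1)) := by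
      rw [hs, ← neg_one_smul ℝ, act_smul, act_inv_dir hW, neg_one_smul]
    rw [h6, zVec]
    abel
  have h7 : ‖gradient H (y (n + 2))‖ ≤ 2 * ω n * ‖sVec y (n + 1)‖ := by
    rw [h5]
    exact (norm_sub_le _ _).trans (by linarith)
  have h8 := h.mul_norm_le (y (n + 2)) yStar
  rw [hstar, sub_zero] at h8
  have h9 : ‖sVec y (n + 1)‖ ≤ ‖y (n + 2) - yStar‖ + ‖y (n + 1) - yStar‖ := by
    rw [sVec, ← sub_sub_sub_cancel_right _ _ yStar]
    exact norm_sub_le _ _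
  have hsn := norm_pos_iff.2 (hWs (n + 1)).2
  have h10 : μ * ‖y (n + 2) - yStar‖ * (1 + c)
      ≤ c * μ * (‖y (n + 2) - yStar‖ + ‖y (n + 1) - yStar‖) := by
    calc _ ≤ 2 * ω n * ‖sVec y (n + 1)‖ * (1 + c) := 
          mul_le_mul_of_nonneg_right (h8.trans h7) (by positivity)
      _ = 2 * ω n * (1 + c) * ‖sVec y (n + 1)‖ := by ring
      _ ≤ c * μ * ‖sVec y (n + 1)‖ := by gcongr
      _ ≤ _ := by gcongr
  have h11 : μ * ‖y (n + 2) - yStar‖ ≤ μ * (c * ‖y (n + 1) - yStar‖) := by linarith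
  exact le_of_mul_le_mul_left h11 hμ

theorem IsRun.eq_of_stationary (hrun : IsRun H γ σ δ B₀ y W η) {k : ℕ} (hk : 1 ≤ k)
    (h0 : gradient H (y k) = 0) : ∀ n, k ≤ n → y n = y k := by
  intro n hn
  induction n, hn using Nat.le_induction with
  | base => rfl
  | succ n hn ih =>
    rw [hrun.update_point n (hk.trans hn), dir, ih, h0, act_zero, smul_zero, sub_zero]

end Late
end QND2R

theorem theorem1 (m d : ℕ) (hm : 0 < m)
    (f : Fin m → QND2R.Vec d → ℝ)
    (hf1 : QND2R.Assumption1 f) (hf2 : QND2R.Assumption2 f)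
    (lam γ σ δ : ℝ) (hlam : 0 < lam) (hγ : γ = lam / (3 * m))
    (hσ : σ ∈ Set.Ioo (0 : ℝ) (1 / 2)) (hδ : δ ∈ Set.Ioo (0 : ℝ) (lam / (3 * m)))
    (B₀ : QND2R.Mat m d) (hB₀ : B₀.PosDef)
    (y : ℕ → QND2R.Stack m d) (W : ℕ → QND2R.Mat m d) (η : ℕ → ℝ)
    (hrun : QND2R.IsRun (QND2R.envelope f lam γ) γ σ δ B₀ y W η) :
    ∃ yStar : QND2R.Stack m d,
      -- `yStar` is the unique minimizer of the envelope
      (∀ u, QND2R.envelope f lam γ yStar ≤ QND2R.envelope f lam γ u) ∧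
      (∀ u, (∀ v, QND2R.envelope f lam γ u ≤ QND2R.envelope f lam γ v) → u = yStar) ∧
      -- superlinear convergence
      Filter.Tendsto y Filter.atTop (nhds yStar) ∧
      (fun k => y (k + 1) - yStar) =o[Filter.atTop] (fun k => y k - yStar) ∧
      -- the unit stepsize passes the test, and is taken, in every late round that does not
      -- start at the minimizer
      (∀ᶠ k in Filter.atTop, y k ≠ yStar →
        (¬ QND2R.CondA (QND2R.envelope f lam γ) γ σ y W k ∧
          QND2R.CondB (QND2R.envelope f lam γ) σ y W k) ∧ η k = 1) := by
  have hm' : (0 : ℝ) < m := by positivity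
  have hγ0 : 0 < γ := by rw [hγ]; positivity
  rw [← hγ] at hδ
  obtain ⟨μ, ℓ, h, hup⟩ := QND2R.envelope_regular hm hf1 hf2 hlam hγ
  obtain ⟨yStar, hstar, hmin⟩ := h.exists_grad_eq_zero
  have huniq : ∀ u, QND2R.envelope f lam γ u ≤ QND2R.envelope f lam γ yStar → u = yStar := by
    intro u hu
    have h1 := h.quadratic_growth u yStar
    rw [hstar, inner_zero_left] at h1
    have h2 : ‖u - yStar‖ ^ 2 ≤ 0 := by nlinarith [h.mu_pos]
    have h3 := pow_eq_zero_iff two_ne_zero |>.1 (le_antisymm h2 (sq_nonneg _))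
    exact sub_eq_zero.1 (norm_eq_zero.1 h3)
  refine ⟨yStar, hmin, fun u hu => huniq u (hu yStar), ?_⟩
  by_cases hne : ∀ k, 1 ≤ k → gradient (QND2R.envelope f lam γ) (y k) ≠ 0
  · obtain ⟨h1, h2, h3⟩ := hrun.superlinear_of_ne h hγ0 hup hσ hδ hB₀ hstar hne
    exact ⟨h1, h2, h3.mono fun k hk _ => hk⟩
  · push Not at hne
    obtain ⟨k, hk, h0⟩ := hne
    have hyk : y k = yStar := huniq _ (by
      have := h.subgrad yStar (y k)
      rwa [h0, inner_zero_left, add_zero] at this)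
    have hev : ∀ᶠ n in Filter.atTop, y n = yStar :=
      Filter.eventually_atTop.2 ⟨k, fun n hn => by rw [hrun.eq_of_stationary hk h0 n hn, hyk]⟩
    refine ⟨tendsto_nhds_of_eventually_eq hev, ?_, hev.mono fun n hn hn' => absurd hn hn'⟩
    have hev' : (fun n => y (n + 1) - yStar) =ᶠ[Filter.atTop] fun _ => 0 := by
      filter_upwards [(Filter.tendsto_add_atTop_nat 1).eventually hev] with n hn
      rw [hn, sub_self]
    exact hev'.trans_isLittleO (Asymptotics.isLittleO_zero _ _)
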